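/- \textbf{Setting.} Fix $n_1\ge 1$. Transactions arrive one after another, and each new one approves an ordered pair of (not necessarily distinct) earlier transactions. A \emph{window} is a directed multigraph on $n_1$ vertices ordered by age, with edges from younger to older vertices and at most two outgoing edges per vertex; it describes the restriction of the tangle to its last $n_1$ transactions. An \emph{attachment method} assigns to each window a probability distribution on ordered pairs of its vertices. The honest nodes use a fixed \emph{default strategy}, which consists of an attachment method $\mathcal S_0$ and, for each window, the law of the vertex at which the default tip-selecting walk ends. Let $\mathcal G_{n_1}$ be the (finite, non-empty) set of possible windows, closed under attaching transactions by $\mathcal S_0$. Assume that, when all nodes use $\mathcal S_0$, the window is an irreducible and aperiodic Markov chain on $\mathcal G_{n_1}$. Fix $\kappa>0$ and an integer $M_0\ge 1$. There are $N$ selfish nodes; each transaction, independently of the past, is issued by an honest node with probability $\frac{\kappa}{\kappa+1}$ and by the $k$th selfish node with probability $\frac{1}{(\kappa+1)N}$, $k=1,\dots,N$. The issuer samples the approved pair from its own strategy applied to the current window. The selfish nodes' strategies belong to the set $\mathcal Q$ of all probabilistic mixtures of methods from a given set of simple attachment methods, each of which also maps $\mathcal G_{n_1}$ into itself. At the arrival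 of each transaction, just before it is attached, a default walk is run on the current window. Transaction $u$ \emph{references} transaction $v$ if there is a directed path, with at least one edge, from $u$ to $v$ in the approval graph. For a transaction $v$, let $W(v)$ be the number of those among the walks run at the arrivals of the $M_0$ transactions following $v$ that end in a vertex which does not reference $v$. If $v^{(k)}_1,v^{(k)}_2,\dots$ are the transactions issued by the $k$th selfish node, its \emph{mean cost} is $$\mathfrak C^{(k)}(\mathcal S_1,\dots,\mathcal S_N)=M_0^{-1}\lim_{n\to\infty}\frac{W(v^{(k)}_1)+\cdots+W(v^{(k)}_n)}{n}\quad\text{(almost sure limit)}.$$ A vector $(\mathcal S_1,\dots,\mathcal S_N)\in\mathcal Q^N$ is a \emph{Nash equilibrium} if, for every $k$ and every $\mathcal S'\in\mathcal Q$, replacing $\mathcal S_k$ by $\mathcal S'$ does not decrease $\mathfrak C^{(k)}$. \textbf{Theorem.} For every $\varepsilon>0$ there exists $N_0$, which depends on the default strategy (and on $n_1,\mathcal G_{n_1},\kappa,M_0,\varepsilon$) but not on the set of simple strategies, such that for all $N\ge N_0$ (with $N\ge1$) the mean costs are well defined for all strategy vectors in $\mathcal Q^N$ (the almost sure limit exists,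 is constant, and does not depend on the initial window in $\mathcal G_{n_1}$), and for any Nash equilibrium $(\mathcal S_1,\dots,\mathcal S_N)$ $$\big|\mathfrak C^{(k)}(\mathcal S_1,\dots,\mathcal S_N)-\mathfrak C^{(j)}(\mathcal S_1,\dots,\mathcal S_N)\big|<\varepsilon\qquad\text{for all }k,j\in\{1,\dots,N\}.$$ -/

import Mathlib

open MeasureTheory ProbabilityTheory Filter Topology
open scoped NNReal ENNReal

namespace Tangle

/-- The restriction of the tangle to its last `n` transactions: a directed multigraph whose vertices
are numbered by age (`0` is the most recent transaction, `n - 1` the oldest one).  `m i j` is the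
number of edges from `i` to `j`, i.e. how many times `i` approves `j`.  Edges point from younger to
older vertices, and every vertex has at most two outgoing edges (edges to transactions that are
older than the last `n` ones are not seen). Vertices carry no data. -/
def Window (n : ℕ) : Type :=
  {m : Fin n → Fin n → ℕ // (∀ i j, m i j ≠ 0 → i < j) ∧ ∀ i, ∑ j, m i j ≤ 2}

/-- The edge multiplicities after a new transaction approving the vertices `p.1` and `p.2` has been
attached: the new transaction becomes vertex `0`, vertex `i` becomes vertex `i + 1`, and the oldest
vertex is forgotten. -/
def attachMult {n : ℕ} (m : Fin n → Fin n → ℕ) (p : Fin n × Fin n) (i j : Fin n) : ℕ :=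
  if hj : j.val = 0 then 0
  else
    let j' : Fin n := ⟨j.val - 1, by omega⟩
    if hi : i.val = 0 then (if p.1 = j' then 1 else 0) + (if p.2 = j' then 1 else 0)
    else m ⟨i.val - 1, by omega⟩ j'

theorem sum_pred_le {n : ℕ} (f : Fin n → ℕ) :
    (∑ j : Fin n, if hj : j.val = 0 then 0 else f ⟨j.val - 1, by omega⟩) ≤ ∑ j, f j := by
  cases n with
  | zero => simp
  | succ n =>
    rw [Fin.sum_univ_succ, Fin.sum_univ_castSucc f]
    refine le_trans (le_of_eq ?_) (Nat.le_add_right (∑ i : Fin n, f (Fin.castSucc i)) _)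
    simp only [Fin.val_zero, Fin.val_succ, Nat.add_eq_zero_iff, one_ne_zero,
      and_false, dite_false, Nat.add_sub_cancel]
    simp
    rfl

/-- The window seen after a new transaction approving `p.1` and `p.2` has been attached. -/
def Window.attach {n : ℕ} (x : Window n) (p : Fin n × Fin n) : Window n :=
  ⟨attachMult x.1 p, by
    constructor
    · intro i j h
      rw [Fin.lt_def]
      unfold attachMult at h
      by_cases hj : j.val = 0
      · simp [hj] at h
      · by_cases hi : i.val = 0
        · omega
        · simp only [hj, hi, dite_false] at h
          have := x.2.1 _ _ h
          rw [Fin.lt_def] at this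
          simp only at this
          omega
    · intro i
      by_cases hi : i.val = 0
      · refine le_trans (le_of_eq ?_) (le_trans (sum_pred_le
          (fun j => (if p.1 = j then 1 else 0) + (if p.2 = j then 1 else 0))) ?_)
        · refine Finset.sum_congr rfl fun j _ => ?_
          simp [attachMult, hi]
        · simp [Finset.sum_add_distrib]
      · refine le_trans (le_of_eq ?_) (le_trans (sum_pred_le
          (fun j => x.1 ⟨i.val - 1, by omega⟩ j)) (x.2.2 _))
        refine Finset.sum_congr rfl fun j _ => ?_
        simp [attachMult, hi]⟩

/-- An attachment method: to every restriction of the tangle to the last `n` transactions it assigns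
a probability distribution on the ordered pairs of (not necessarily distinct) vertices. -/
abbrev AttachmentMethod (n : ℕ) : Type := Window n → PMF (Fin n × Fin n)

/-- A default attachment strategy. `exit x` is the law of the vertex at which the default
tip-selecting walk run on `x` ends, and `attach x` is the law of the pair of vertices that an
honest node approves when it sees `x` (typically the end points of two runs of the walk). Both are
arbitrary functions of the window; they may ignore its most recent vertices (network delay). -/
structure DefaultStrategy (n : ℕ) where
  exit : Window n → PMF (Fin n)
  attach : AttachmentMethod n

/-- The mixed strategies with simple strategies in `A`: choose a simple strategy at random
according to some distribution `Ξ` and apply it. -/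
def mixedStrategies {n : ℕ} (A : Set (AttachmentMethod n)) : Set (AttachmentMethod n) :=
  {S | ∃ Ξ : PMF A, ∀ x, S x = Ξ.bind fun β => β.1 x}

/-- `E` is closed under attaching transactions with the method `S`. -/
def ClosedUnder {n : ℕ} (E : Finset (Window n)) (S : AttachmentMethod n) : Prop :=
  ∀ x ∈ E, ∀ p ∈ (S x).support, x.attach p ∈ E

/-- The transition matrix on `E` of the window when all nodes use the method `S`. -/
noncomputable def transitionMatrix {n : ℕ} (E : Finset (Window n)) (S : AttachmentMethod n) :
    Matrix E E ℝ :=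
  fun x y => (((S x.1).map x.1.attach) y.1).toReal

/-- Aperiodicity: for every state, the greatest common divisor of its possible return times
is one. -/
def Aperiodic {ι : Type*} [Fintype ι] [DecidableEq ι] (P : Matrix ι ι ℝ) : Prop :=
  ∀ i, ∀ d : ℕ, (∀ n : ℕ, 0 < n → 0 < (P ^ n) i i → d ∣ n) → d = 1

open Classical in
/-- When all nodes use the default strategy, the window is an irreducible and aperiodic Markov chain
on the state space `E`. -/
def AssumptionD {n : ℕ} (E : Finset (Window n)) (D : DefaultStrategy n) : Prop :=
  E.Nonempty ∧ ClosedUnder E D.attach ∧ (transitionMatrix E D.attach).IsIrreducible ∧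
    Aperiodic (transitionMatrix E D.attach)

/-- Probability that a transaction is issued by an honest node (`none`), resp. by the selfish
node `k` (`some k`): the honest nodes together issue transactions at rate `κ / (κ + 1)` times the
total rate, and each of the `N` selfish ones at rate `1 / ((κ + 1) N)` times the total rate. -/
noncomputable def issuerWeight (κ : ℝ≥0) (N : ℕ) : Option (Fin N) → ℝ≥0
  | none => κ / (κ + 1)
  | some _ => 1 / ((κ + 1) * N)

/-- The law of the issuer of a transaction. -/
noncomputable def issuerLaw (κ : ℝ≥0) (N : ℕ) [NeZero N] : PMF (Option (Fin N)) :=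
  PMF.ofFintype (fun o => (issuerWeight κ N o : ℝ≥0∞)) (by
    have hN : (N : ℝ≥0) ≠ 0 := Nat.cast_ne_zero.mpr (NeZero.ne N)
    have hκ : κ + 1 ≠ 0 := by positivity
    have h : ∑ o, issuerWeight κ N o = 1 := by
      rw [Fintype.sum_option]
      simp only [issuerWeight, Finset.sum_const, Finset.card_univ, Fintype.card_fin, nsmul_eq_mul]
      field_simp
    exact_mod_cast congrArg (fun r : ℝ≥0 => (r : ℝ≥0∞)) h)

/-- What happens at the arrival of a transaction. -/
structure Record (n N : ℕ) where
  /-- the window just before the transaction is attached -/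
  window : Window n
  /-- the node that issues the transaction (`none` is an honest node) -/
  issuer : Option (Fin N)
  /-- the vertices of `window` that the transaction approves -/
  approved : Fin n × Fin n
  /-- the vertex of `window` at which a default tip-selecting walk, run just before the transaction
  is attached, ends -/
  endpoint : Fin n

instance (n N : ℕ) : MeasurableSpace (Record n N) := ⊤

instance (n N : ℕ) : DiscreteMeasurableSpace (Record n N) := ⟨fun _ => trivial⟩

/-- The method used by each issuer. -/
def methodOf {n N : ℕ} (D : DefaultStrategy n) (s : Fin N → AttachmentMethod n) :
    Option (Fin N) → AttachmentMethod n
  | none => D.attach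
  | some k => s k

/-- The law of the record of a transaction that arrives when the window is `x`. -/
noncomputable def recordLaw {n N : ℕ} [NeZero N] (D : DefaultStrategy n) (κ : ℝ≥0)
    (s : Fin N → AttachmentMethod n) (x : Window n) : PMF (Record n N) :=
  (issuerLaw κ N).bind fun o => (methodOf D s o x).bind fun p => (D.exit x).map fun y => ⟨x, o, p, y⟩

/-- The transition kernel: attach the last transaction, then let the next one arrive. -/
noncomputable def nextRecord {n N : ℕ} [NeZero N] (D : DefaultStrategy n) (κ : ℝ≥0)
    (s : Fin N → AttachmentMethod n) (t : ℕ) :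
    Kernel ((_ : Finset.Iic t) → Record n N) (Record n N) where
  toFun h :=
    let z := h ⟨t, Finset.mem_Iic.mpr le_rfl⟩
    (recordLaw D κ s (z.window.attach z.approved)).toMeasure
  measurable' := (Measurable.of_discrete (f := fun z : Record n N =>
    (recordLaw D κ s (z.window.attach z.approved)).toMeasure)).comp (measurable_pi_apply _)

instance {n N : ℕ} [NeZero N] (D : DefaultStrategy n) (κ : ℝ≥0)
    (s : Fin N → AttachmentMethod n) (t : ℕ) : IsMarkovKernel (nextRecord D κ s t) :=
  ⟨fun h => PMF.toMeasure.isProbabilityMeasure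
    (recordLaw D κ s ((h ⟨t, Finset.mem_Iic.mpr le_rfl⟩).window.attach
      (h ⟨t, Finset.mem_Iic.mpr le_rfl⟩).approved))⟩

/-- The law of the evolution of the tangle, started from the window `x`, when the selfish nodes use
the strategies `s`; transactions are numbered `0, 1, 2, …` in the order of arrival. -/
noncomputable def tangleLaw {n N : ℕ} [NeZero N] (D : DefaultStrategy n) (κ : ℝ≥0)
    (s : Fin N → AttachmentMethod n) (x : Window n) : Measure (ℕ → Record n N) :=
  Kernel.trajMeasure (X := fun _ => Record n N) (recordLaw D κ s x).toMeasure (nextRecord D κ s)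

/-- Transaction `t` approves transaction `u`: vertex `i` of the window that is present when `t`
arrives is the transaction `t - 1 - i`. -/
def Approves {n N : ℕ} (ω : ℕ → Record n N) (t u : ℕ) : Prop :=
  t = u + 1 + (ω t).approved.1 ∨ t = u + 1 + (ω t).approved.2

/-- Transaction `t` references transaction `u`: there is a directed path from `t` to `u`. -/
def References {n N : ℕ} (ω : ℕ → Record n N) : ℕ → ℕ → Prop :=
  Relation.TransGen (Approves ω)

/-- The default walk run at the arrival time of transaction `t` ends in a vertex that
references `v`. -/
def WalkReferences {n N : ℕ} (ω : ℕ → Record n N) (t v : ℕ) : Prop :=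
  ∃ u, t = u + 1 + (ω t).endpoint ∧ References ω u v

open Classical in
/-- `W(v)`: how many of the default walks run at the arrival times of the `M` transactions that
follow `v` end in a vertex that does not reference `v`. -/
noncomputable def W {n N : ℕ} (M : ℕ) (ω : ℕ → Record n N) (v : ℕ) : ℕ :=
  ∑ k ∈ Finset.Icc 1 M, if WalkReferences ω (v + k) v then 0 else 1

/-- The `j`-th transaction (counted from `0`) issued by the selfish node `k`. -/
noncomputable def issued {n N : ℕ} (ω : ℕ → Record n N) (k : Fin N) (j : ℕ) : ℕ :=
  Nat.nth (fun t => (ω t).issuer = some k) j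

/-- `c` is the mean cost of the selfish node `k`: whatever the initial window in `E`, almost surely
node `k` issues infinitely many transactions and `c` is `1 / M` times the limit of the averages
of `W` over its first `m` transactions. -/
def IsMeanCost {n N : ℕ} [NeZero N] (E : Finset (Window n)) (D : DefaultStrategy n) (κ : ℝ≥0)
    (M : ℕ) (s : Fin N → AttachmentMethod n) (k : Fin N) (c : ℝ) : Prop :=
  ∀ x ∈ E, ∀ᵐ ω ∂(tangleLaw D κ s x),
    {t | (ω t).issuer = some k}.Infinite ∧
    Tendsto (fun m : ℕ => (M : ℝ)⁻¹ * ((∑ j ∈ Finset.range m, (W M ω (issued ω k j) : ℝ)) / m))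
      atTop (𝓝 c)

open Classical in
/-- The mean cost of the selfish node `k` (zero if it does not exist). -/
noncomputable def meanCost {n N : ℕ} [NeZero N] (E : Finset (Window n)) (D : DefaultStrategy n)
    (κ : ℝ≥0) (M : ℕ) (s : Fin N → AttachmentMethod n) (k : Fin N) : ℝ :=
  if h : ∃ c, IsMeanCost E D κ M s k c then h.choose else 0

/-- Nash equilibria in which all strategies belong to `Q`. -/
def IsNashEquilibrium {n N : ℕ} [NeZero N] (E : Finset (Window n)) (D : DefaultStrategy n)
    (κ : ℝ≥0) (M : ℕ) (Q : Set (AttachmentMethod n)) (s : Fin N → AttachmentMethod n) : Prop :=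
  (∀ k, s k ∈ Q) ∧ ∀ k, ∀ S' ∈ Q,
    meanCost E D κ M s k ≤ meanCost E D κ M (Function.update s k S') k

end Tangle

namespace Tangle

/-! ### The law of the tangle: cylinder probabilities and the Markov property -/

section TangleLaw

/-! The proof is a copying argument. In an equilibrium, node `k` does not gain by imitating node
`j`. After the imitation `k` pays almost what `j` paid before, because one node issues a transaction
with probability `w ≤ 1/N` and hence hardly affects the system. So the cost of `k` exceeds that of
`j` by at most `w * K`, and the roles can be exchanged.

The estimate has to be uniform in `N` and in the strategies. Let `f x` be the expected number of
walks missing a transaction attached to the window `x` by the node in question, and `P` the window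
chain. The Poisson equation `f - c = g - P g` identifies `c` as the long-run average of `f`, and the
mean cost is `c / M`. Honest nodes act with probability `κ / (κ + 1)`, so `P` dominates that
multiple of the fixed irreducible default matrix. This bounds the oscillation of `g` uniformly
(`exists_oscillation_bound`). Changing one strategy moves `f` and `P g` by `O(w)`. Subtracting the
two Poisson equations and applying the maximum principle (`abs_const_le_of_poisson`) gives `c' - c =
O(w)`; this is `exists_abs_meanCost_update_sub_le`.

The costs exist because the realised cost, corrected by increments of `w * g`, has mean zero from
every window. Its time shifts are therefore orthogonal at large distance, and a second-moment law of
large numbers applies; the correction telescopes. -/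

instance (n : ℕ) : Finite (Window n) := by
  have hle : ∀ (x : Window n) (i j : Fin n), x.1 i j < 3 := fun x i j =>
    Nat.lt_succ_of_le ((Finset.single_le_sum (f := fun j => x.1 i j) (fun _ _ => Nat.zero_le _)
      (Finset.mem_univ j)).trans (x.2.2 i))
  refine Finite.of_injective (β := Fin n → Fin n → Fin 3) (fun x i j => ⟨x.1 i j, hle x i j⟩) ?_
  intro x y h
  refine Subtype.ext (funext fun i => funext fun j => ?_)
  simpa using congrFun (congrFun h i) j

/-- Records as tuples. -/
def recordEquiv (n N : ℕ) :
    Record n N ≃ Window n × Option (Fin N) × (Fin n × Fin n) × Fin n where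
  toFun z := ⟨z.window, z.issuer, z.approved, z.endpoint⟩
  invFun z := ⟨z.1, z.2.1, z.2.2.1, z.2.2.2⟩

instance (n N : ℕ) : Finite (Record n N) := Finite.of_equiv _ (recordEquiv n N).symm

noncomputable instance (n N : ℕ) : Fintype (Record n N) := Fintype.ofFinite _

noncomputable instance (n : ℕ) : Fintype (Window n) := Fintype.ofFinite _

variable {n N : ℕ}

/-- The window after the recorded transaction has been attached. -/
def Record.next (z : Record n N) : Window n := z.window.attach z.approved

/-- Prepend a term to a sequence. -/
def consSeq {α : Type*} (z : α) (ω : ℕ → α) : ℕ → α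
  | 0 => z
  | t + 1 => ω t

@[simp] theorem consSeq_zero {α : Type*} (z : α) (ω : ℕ → α) : consSeq z ω 0 = z := rfl

@[simp] theorem consSeq_succ {α : Type*} (z : α) (ω : ℕ → α) (t : ℕ) :
    consSeq z ω (t + 1) = ω t := rfl

theorem measurable_consSeq {α : Type*} [MeasurableSpace α] (z : α) :
    Measurable (consSeq z : (ℕ → α) → ℕ → α) := by
  refine measurable_pi_lambda _ fun t => ?_
  cases t with
  | zero => exact measurable_const
  | succ t => exact measurable_pi_apply t

/-- Sequences that agree with `z` up to time `t`. -/
def initialCylinder {α : Type*} (z : ℕ → α) (t : ℕ) : Set (ℕ → α) := {ω | ∀ i ≤ t, ω i = z i}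

theorem preimage_frestrictLe_singleton {α : Type*} (z : ℕ → α) (t : ℕ) :
    Preorder.frestrictLe (π := fun _ => α) t ⁻¹' {Preorder.frestrictLe t z} =
      initialCylinder z t := by
  ext ω
  simp only [Set.mem_preimage, Set.mem_singleton_iff, initialCylinder, Set.mem_ofPred_eq]
  refine ⟨fun h i hi => congrFun h ⟨i, Finset.mem_Iic.mpr hi⟩, fun h => ?_⟩
  funext i
  exact h i.1 (Finset.mem_Iic.mp i.2)

theorem measurableSet_initialCylinder {α : Type*} [MeasurableSpace α] [MeasurableSingletonClass α]
    (z : ℕ → α) (t : ℕ) : MeasurableSet (initialCylinder z t) := by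
  rw [← preimage_frestrictLe_singleton]
  exact (Preorder.measurable_frestrictLe t) (measurableSet_singleton _)

/-- The marginals on `{0, …, t}` live on countable spaces, so their point masses determine them, and
a projective limit is unique. -/
theorem ext_of_initialCylinder {α : Type*} [MeasurableSpace α] [MeasurableSingletonClass α]
    [Countable α] {μ ν : Measure (ℕ → α)} [IsFiniteMeasure μ] [IsFiniteMeasure ν]
    (h : ∀ z t, μ (initialCylinder z t) = ν (initialCylinder z t)) : μ = ν := by
  have hν : IsProjectiveLimit ν (fun I : Finset ℕ => ν.map I.restrict) := fun _ => rfl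
  have hfam : IsProjectiveMeasureFamily (fun I : Finset ℕ => ν.map I.restrict) := by
    intro I J hJI
    rw [Measure.map_map (Finset.measurable_restrict₂ hJI) (Finset.measurable_restrict I)]
    rfl
  have hμ : IsProjectiveLimit μ (fun I : Finset ℕ => ν.map I.restrict) := by
    rw [isProjectiveLimit_nat_iff hfam]
    intro t
    refine Measure.ext_of_singleton fun a => ?_
    rcases isEmpty_or_nonempty (ℕ → α) with hE | ⟨⟨ω₀⟩⟩
    · rw [Measure.eq_zero_of_isEmpty μ, Measure.eq_zero_of_isEmpty ν]
      simp
    · obtain ⟨z, rfl⟩ : ∃ z : ℕ → α, Preorder.frestrictLe (π := fun _ => α) t z = a := by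
        classical
        refine ⟨fun i => if hi : i ∈ Finset.Iic t then a ⟨i, hi⟩ else ω₀ i, ?_⟩
        funext i
        simp only [Preorder.frestrictLe_apply]
        rw [dif_pos i.2]
      rw [Measure.map_apply (Preorder.measurable_frestrictLe t) (measurableSet_singleton _)]
      erw [Measure.map_apply (Preorder.measurable_frestrictLe t) (measurableSet_singleton _)]
      rw [preimage_frestrictLe_singleton]
      exact h z t
  exact hμ.unique hν

variable [NeZero N] (D : DefaultStrategy n) (κ : ℝ≥0) (s : Fin N → AttachmentMethod n)

instance (x : Window n) : IsProbabilityMeasure (recordLaw D κ s x).toMeasure :=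
  PMF.toMeasure.isProbabilityMeasure _

instance (x : Window n) : IsProbabilityMeasure (tangleLaw D κ s x) := by
  unfold tangleLaw
  infer_instance

theorem tangleLaw_initialCylinder (x : Window n) (z : ℕ → Record n N) (t : ℕ) :
    tangleLaw D κ s x (initialCylinder z t) =
      recordLaw D κ s x (z 0) *
        ∏ i ∈ Finset.range t, recordLaw D κ s (z i).next (z (i + 1)) := by
  induction t with
  | zero =>
    have h0 : (tangleLaw D κ s x).map (Preorder.frestrictLe 0) =
        (recordLaw D κ s x).toMeasure.map
          (MeasurableEquiv.piUnique (fun _ : Finset.Iic 0 => Record n N)).symm := by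
      unfold tangleLaw Kernel.trajMeasure
      rw [Measure.map_comp _ _ (by fun_prop), Kernel.traj_map_frestrictLe]
      simp
    rw [← preimage_frestrictLe_singleton,
      ← Measure.map_apply (Preorder.measurable_frestrictLe 0) (measurableSet_singleton _), h0,
      Measure.map_apply (MeasurableEquiv.measurable _) (measurableSet_singleton _)]
    have : (MeasurableEquiv.piUnique (fun _ : Finset.Iic 0 => Record n N)).symm ⁻¹'
        {Preorder.frestrictLe 0 z} = {z 0} := by
      ext y
      simp only [Set.mem_preimage, Set.mem_singleton_iff]
      rw [MeasurableEquiv.symm_apply_eq]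
      rfl
    rw [this, PMF.toMeasure_apply_singleton _ _ (measurableSet_singleton _)]
    simp
  | succ t ih =>
    have hc := Kernel.map_frestrictLe_trajMeasure_compProd_eq_map_trajMeasure
      (X := fun _ => Record n N) (μ₀ := (recordLaw D κ s x).toMeasure)
      (κ := nextRecord D κ s) (a := t)
    have hpre : initialCylinder z (t + 1) =
        (fun ω : ℕ → Record n N =>
          (Preorder.frestrictLe (π := fun _ => Record n N) t ω, ω (t + 1))) ⁻¹'
          ({Preorder.frestrictLe t z} ×ˢ {z (t + 1)}) := by
      rw [Set.mk_preimage_prod, preimage_frestrictLe_singleton]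
      ext ω
      simp only [initialCylinder, Set.mem_ofPred_eq, Set.mem_inter_iff, Set.mem_preimage,
        Set.mem_singleton_iff]
      refine ⟨fun h => ⟨fun i hi => h i (by omega), h _ le_rfl⟩, fun h i hi => ?_⟩
      rcases Nat.le_succ_iff.mp hi with hi | rfl
      · exact h.1 i hi
      · exact h.2
    rw [hpre, ← Measure.map_apply (by fun_prop)
      ((measurableSet_singleton _).prod (measurableSet_singleton _))]
    unfold tangleLaw at ih ⊢
    rw [← hc, Measure.compProd_apply_prod (measurableSet_singleton _) (measurableSet_singleton _),
      lintegral_singleton,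
      Measure.map_apply (Preorder.measurable_frestrictLe t) (measurableSet_singleton _),
      preimage_frestrictLe_singleton, ih, Finset.prod_range_succ]
    have : nextRecord D κ s t (Preorder.frestrictLe t z) {z (t + 1)} =
        recordLaw D κ s (z t).next (z (t + 1)) :=
      PMF.toMeasure_apply_singleton _ _ (measurableSet_singleton _)
    rw [this]
    ring

/-- First-step decomposition, the form of the Markov property behind every later induction on time.
On a cylinder only the summand with the prescribed first record survives, and the product formula
splits off its first factor. -/
theorem tangleLaw_eq_sum (x : Window n) :
    tangleLaw D κ s x =
      ∑ z, recordLaw D κ s x z • (tangleLaw D κ s z.next).map (consSeq z) := by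
  have hmap : ∀ z : Record n N, IsProbabilityMeasure ((tangleLaw D κ s z.next).map (consSeq z)) :=
    fun z => Measure.isProbabilityMeasure_map (measurable_consSeq z).aemeasurable
  have : ∀ z : Record n N,
      IsFiniteMeasure (recordLaw D κ s x z • (tangleLaw D κ s z.next).map (consSeq z)) :=
    fun z => Measure.smul_finite _ (PMF.apply_ne_top _ _)
  refine ext_of_initialCylinder fun z t => ?_
  rw [Measure.finsetSum_apply, Finset.sum_eq_single (z 0)]
  · rw [Measure.smul_apply, Measure.map_apply (measurable_consSeq _)
      (measurableSet_initialCylinder _ _), tangleLaw_initialCylinder, smul_eq_mul]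
    congr 1
    cases t with
    | zero =>
      have : consSeq (z 0) ⁻¹' initialCylinder z 0 = Set.univ := by
        ext ω
        simp [initialCylinder]
      simp [this]
    | succ t =>
      have : consSeq (z 0) ⁻¹' initialCylinder z (t + 1) =
          initialCylinder (fun i => z (i + 1)) t := by
        ext ω
        simp only [initialCylinder, Set.mem_preimage, Set.mem_ofPred_eq]
        refine ⟨fun h i hi => h (i + 1) (by omega), fun h i hi => ?_⟩
        cases i with
        | zero => rfl
        | succ i => exact h i (by omega)
      rw [this, tangleLaw_initialCylinder, Finset.prod_range_succ']
      ring
  · intro y _ hy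
    have : consSeq y ⁻¹' initialCylinder z t = ∅ := by
      ext ω
      simp only [initialCylinder, Set.mem_preimage, Set.mem_ofPred_eq, Set.mem_empty_iff_false,
        iff_false]
      exact fun h => hy (h 0 (Nat.zero_le _))
    rw [Measure.smul_apply, Measure.map_apply (measurable_consSeq _)
      (measurableSet_initialCylinder _ _), this]
    simp
  · simp

theorem integral_tangleLaw (x : Window n) {F : (ℕ → Record n N) → ℝ} (hF : Measurable F)
    {C : ℝ} (hC : ∀ ω, |F ω| ≤ C) :
    ∫ ω, F ω ∂(tangleLaw D κ s x) =
      ∑ z, (recordLaw D κ s x z).toReal * ∫ ω, F (consSeq z ω) ∂(tangleLaw D κ s z.next) := by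
  have hmap : ∀ z : Record n N, IsProbabilityMeasure ((tangleLaw D κ s z.next).map (consSeq z)) :=
    fun z => Measure.isProbabilityMeasure_map (measurable_consSeq z).aemeasurable
  rw [tangleLaw_eq_sum, integral_finsetSum_measure]
  · refine Finset.sum_congr rfl fun z _ => ?_
    rw [integral_smul_measure, integral_map (measurable_consSeq z).aemeasurable
      hF.aestronglyMeasurable, smul_eq_mul]
  · intro z _
    refine Integrable.smul_measure ?_ (PMF.apply_ne_top _ _)
    exact Integrable.of_bound hF.aestronglyMeasurable C (ae_of_all _ hC)

theorem measurable_of_dependsOn_Iio {α : Type*} [MeasurableSpace α]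
    [MeasurableSingletonClass α] [Countable α] {F : (ℕ → α) → ℝ} {t : ℕ}
    (hF : DependsOn F (Set.Iio t)) : Measurable F := by
  rcases isEmpty_or_nonempty (ℕ → α) with hE | ⟨⟨ω₀⟩⟩
  · exact measurable_of_empty F
  · have : F = (fun u : Fin t → α => F fun i => if hi : i < t then u ⟨i, hi⟩ else ω₀ i) ∘
        fun ω i => ω i := by
      funext ω
      refine hF fun i hi => ?_
      simp [Set.mem_Iio.mp hi]
    rw [this]
    exact (Measurable.of_discrete).comp (measurable_pi_lambda _ fun i => measurable_pi_apply _)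

theorem dependsOn_comp_consSeq {α β : Type*} {F : (ℕ → α) → β} {t : ℕ}
    (hF : DependsOn F (Set.Iio (t + 1))) (z : α) :
    DependsOn (fun ω => F (consSeq z ω)) (Set.Iio t) := by
  intro ω ω' h
  refine hF fun i hi => ?_
  cases i with
  | zero => rfl
  | succ i => exact h i (Set.mem_Iio.mpr (by have := Set.mem_Iio.mp hi; omega))

end TangleLaw

/-! ### A law of large numbers from second moments -/

section LawOfLargeNumbers

variable {Ω : Type*} [MeasurableSpace Ω] {μ : Measure Ω} [IsProbabilityMeasure μ]

/-- The second moment of the partial sums of a bounded sequence grows at most linearly if terms at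
distance at least `L` are orthogonal. -/
theorem integral_sq_sum_le {Y : ℕ → Ω → ℝ} {C : ℝ} {L : ℕ} (hY : ∀ t, Measurable (Y t))
    (hC : ∀ t ω, |Y t ω| ≤ C) (hC0 : 0 ≤ C)
    (horth : ∀ s t, s + L ≤ t → ∫ ω, Y s ω * Y t ω ∂μ = 0) (T : ℕ) :
    ∫ ω, (∑ t ∈ Finset.range T, Y t ω) ^ 2 ∂μ ≤ (2 * L + 1) * C ^ 2 * T := by
  have hint : ∀ s t, Integrable (fun ω => Y s ω * Y t ω) μ := fun s t =>
    Integrable.of_bound ((hY s).mul (hY t)).aestronglyMeasurable (C * C) (ae_of_all _ fun ω => by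
      rw [Real.norm_eq_abs, abs_mul]
      exact mul_le_mul (hC s ω) (hC t ω) (abs_nonneg _) hC0)
  have hbd : ∀ s t, ∫ ω, Y s ω * Y t ω ∂μ ≤ C ^ 2 := fun s t => by
    calc ∫ ω, Y s ω * Y t ω ∂μ ≤ ∫ _, C ^ 2 ∂μ := by
          refine integral_mono (hint s t) (integrable_const _) fun ω => ?_
          refine (le_abs_self _).trans ?_
          rw [abs_mul, pow_two]
          exact mul_le_mul (hC s ω) (hC t ω) (abs_nonneg _) hC0
      _ = C ^ 2 := by simp
  induction T with
  | zero => simp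
  | succ T ih =>
    have hexp : ∀ ω, (∑ t ∈ Finset.range (T + 1), Y t ω) ^ 2 =
        (∑ t ∈ Finset.range T, Y t ω) ^ 2 +
          (2 * ∑ t ∈ Finset.range T, Y t ω * Y T ω + Y T ω * Y T ω) := fun ω => by
      rw [Finset.sum_range_succ, ← Finset.sum_mul]
      ring
    have hsq : Integrable (fun ω => (∑ t ∈ Finset.range T, Y t ω) ^ 2) μ := by
      simp_rw [pow_two, Finset.sum_mul_sum]
      exact integrable_finsetSum _ fun i _ => integrable_finsetSum _ fun j _ => hint i j
    have hcross : Integrable (fun ω => ∑ t ∈ Finset.range T, Y t ω * Y T ω) μ :=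
      integrable_finsetSum _ fun i _ => hint i T
    simp_rw [hexp]
    have hrest : Integrable
        (fun ω => 2 * ∑ t ∈ Finset.range T, Y t ω * Y T ω + Y T ω * Y T ω) μ :=
      (hcross.const_mul 2).add (hint T T)
    rw [integral_add hsq hrest, integral_add (hcross.const_mul 2) (hint T T), integral_const_mul,
      integral_finsetSum _ fun i _ => hint i T]
    -- Only the last `L` indices before `T` can correlate positively with `Y T`.
    have hsum : ∑ t ∈ Finset.range T, ∫ ω, Y t ω * Y T ω ∂μ ≤ L * C ^ 2 := by
      calc ∑ t ∈ Finset.range T, ∫ ω, Y t ω * Y T ω ∂μ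
          ≤ ∑ t ∈ Finset.range T, if T < t + L then C ^ 2 else 0 := by
            refine Finset.sum_le_sum fun t _ => ?_
            split_ifs with h
            · exact hbd t T
            · exact (horth t T (not_lt.mp h)).le
        _ = ((Finset.range T).filter fun t => T < t + L).card * C ^ 2 := by
            rw [← Finset.sum_filter, Finset.sum_const, nsmul_eq_mul]
        _ ≤ L * C ^ 2 := by
            refine mul_le_mul_of_nonneg_right ?_ (sq_nonneg C)
            have hsub : ((Finset.range T).filter fun t => T < t + L) ⊆ Finset.Ico (T - L) T := by
              intro t ht
              simp only [Finset.mem_filter, Finset.mem_range] at ht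
              simp only [Finset.mem_Ico]
              omega
            have := Finset.card_le_card hsub
            rw [Nat.card_Ico] at this
            exact_mod_cast this.trans (by omega)
    have := hbd T T
    push_cast
    nlinarith [ih, hsum, this]

/-- A law of large numbers for bounded sequences in which terms at distance at least `L` are
orthogonal. -/
theorem tendsto_average_of_orthogonal {Y : ℕ → Ω → ℝ} {C : ℝ} {L : ℕ}
    (hY : ∀ t, Measurable (Y t)) (hC : ∀ t ω, |Y t ω| ≤ C)
    (horth : ∀ s t, s + L ≤ t → ∫ ω, Y s ω * Y t ω ∂μ = 0) :
    ∀ᵐ ω ∂μ, Tendsto (fun T : ℕ => (∑ t ∈ Finset.range T, Y t ω) / T) atTop (𝓝 0) := by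
  have hC0 : 0 ≤ C := by
    obtain ⟨ω⟩ : Nonempty Ω := nonempty_of_isProbabilityMeasure μ
    exact (abs_nonneg _).trans (hC 0 ω)
  set S : ℕ → Ω → ℝ := fun T ω => ∑ t ∈ Finset.range T, Y t ω with hS
  have hSm : ∀ T, Measurable (S T) := fun T => Finset.measurable_fun_sum _ fun t _ => hY t
  set K : ℝ := (2 * L + 1) * C ^ 2 with hK
  have hSbd : ∀ T ω, |S T ω| ≤ T * C := fun T ω => by
    refine (Finset.abs_sum_le_sum_abs _ _).trans ?_
    refine (Finset.sum_le_card_nsmul _ _ C fun t _ => hC t ω).trans ?_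
    simp
  have hSint : ∀ T, Integrable (fun ω => S T ω ^ 2) μ := fun T =>
    Integrable.of_bound ((hSm T).pow_const 2).aestronglyMeasurable ((T * C) ^ 2)
      (ae_of_all _ fun ω => by
        rw [Real.norm_eq_abs, abs_pow]
        exact pow_le_pow_left₀ (abs_nonneg _) (hSbd T ω) 2)
  -- Along the squares, the second moment of the average is at most `K / m ^ 2`. The sum of the
  -- squared averages thus has finite expectation and converges almost surely.
  have hsumm : ∀ᵐ ω ∂μ, Summable fun m : ℕ => (S (m ^ 2) ω / (m : ℝ) ^ 2) ^ 2 := by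
    have hi : ∀ m : ℕ, Integrable (fun ω => (S (m ^ 2) ω / (m : ℝ) ^ 2) ^ 2) μ := fun m => by
      simp_rw [div_pow]
      exact (hSint _).div_const _
    have hle : ∀ m : ℕ, ∫ ω, (S (m ^ 2) ω / (m : ℝ) ^ 2) ^ 2 ∂μ ≤ K * (1 / (m : ℝ) ^ 2) := by
      intro m
      simp_rw [div_pow]
      rw [integral_div]
      rcases Nat.eq_zero_or_pos m with rfl | hm
      · simp
      · have := integral_sq_sum_le hY hC hC0 horth (m ^ 2)
        have hm' : (0 : ℝ) < m := by exact_mod_cast hm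
        rw [div_le_iff₀ (by positivity)]
        refine this.trans (le_of_eq ?_)
        push_cast
        field_simp
        exact hK.symm
    have hfin : ∑' m : ℕ, ∫⁻ ω, ENNReal.ofReal ((S (m ^ 2) ω / (m : ℝ) ^ 2) ^ 2) ∂μ ≠ ∞ := by
      have : ∀ m : ℕ, ∫⁻ ω, ENNReal.ofReal ((S (m ^ 2) ω / (m : ℝ) ^ 2) ^ 2) ∂μ =
          ENNReal.ofReal (∫ ω, (S (m ^ 2) ω / (m : ℝ) ^ 2) ^ 2 ∂μ) := fun m =>
        (ofReal_integral_eq_lintegral_ofReal (hi m) (ae_of_all _ fun ω => sq_nonneg _)).symm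
      simp_rw [this]
      refine Summable.tsum_ofReal_ne_top ?_
      refine Summable.of_nonneg_of_le (fun m => integral_nonneg fun ω => sq_nonneg _) hle ?_
      exact (Real.summable_one_div_nat_pow.mpr one_lt_two).mul_left K
    have hmeas : ∀ m : ℕ, Measurable fun ω => ENNReal.ofReal ((S (m ^ 2) ω / (m : ℝ) ^ 2) ^ 2) :=
      fun m => (((hSm _).div_const _).pow_const 2).ennreal_ofReal
    rw [← lintegral_tsum fun m => (hmeas m).aemeasurable] at hfin
    filter_upwards [ae_lt_top (Measurable.tsum hmeas) hfin] with ω hω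
    have := ENNReal.summable_toReal hω.ne
    refine this.congr fun m => ?_
    rw [ENNReal.toReal_ofReal (sq_nonneg _)]
  filter_upwards [hsumm] with ω hω
  have hsq : Tendsto (fun m : ℕ => S (m ^ 2) ω / (m : ℝ) ^ 2) atTop (𝓝 0) := by
    have h2 := hω.tendsto_atTop_zero
    have h3 := (Real.continuous_sqrt.tendsto 0).comp h2
    rw [Real.sqrt_zero] at h3
    refine (tendsto_zero_iff_abs_tendsto_zero _).mpr (h3.congr fun m => ?_)
    simp [Real.sqrt_sq_eq_abs]
  have hroot : Tendsto Nat.sqrt atTop atTop :=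
    tendsto_atTop_atTop.mpr fun b => ⟨b ^ 2, fun a ha => Nat.le_sqrt'.mpr ha⟩
  -- With `m = Nat.sqrt T`, at most `2 * m` terms lie between `m ^ 2` and `T`; they contribute at
  -- most `2 * m * C`, to be divided by `T ≥ m ^ 2`.
  have hbound : Tendsto (fun T : ℕ => |S (Nat.sqrt T ^ 2) ω / (Nat.sqrt T : ℝ) ^ 2| +
      2 * C / (Nat.sqrt T : ℝ)) atTop (𝓝 0) := by
    have h1 := (hsq.comp hroot).abs
    have h2 := ((tendsto_const_div_atTop_nhds_zero_nat (2 * C)).comp hroot)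
    simpa using h1.add h2
  refine squeeze_zero_norm' ?_ hbound
  filter_upwards [eventually_ge_atTop 1] with T hT
  set m := Nat.sqrt T with hm
  have hm1 : 1 ≤ m := Nat.le_sqrt'.mpr (by simpa using hT)
  have hle : m ^ 2 ≤ T := Nat.sqrt_le' T
  have hgap : T - m ^ 2 ≤ 2 * m := by
    have := Nat.sqrt_le_add T
    rw [← hm] at this
    rw [pow_two]
    omega
  have hmR : (0 : ℝ) < m := by exact_mod_cast hm1
  have hTR : (m : ℝ) ^ 2 ≤ T := by exact_mod_cast hle
  have hdiff : |S T ω| ≤ |S (m ^ 2) ω| + 2 * m * C := by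
    have : S T ω = S (m ^ 2) ω + ∑ t ∈ Finset.Ico (m ^ 2) T, Y t ω := by
      simp only [hS]
      rw [Finset.sum_range_add_sum_Ico _ hle]
    rw [this]
    refine (abs_add_le _ _).trans (add_le_add le_rfl ?_)
    refine (Finset.abs_sum_le_sum_abs _ _).trans ?_
    refine (Finset.sum_le_card_nsmul _ _ C fun t _ => hC t ω).trans ?_
    rw [Nat.card_Ico, nsmul_eq_mul]
    refine mul_le_mul_of_nonneg_right ?_ hC0
    exact_mod_cast hgap
  rw [Real.norm_eq_abs, abs_div, abs_div, abs_of_nonneg (by positivity : (0 : ℝ) ≤ T),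
    abs_of_nonneg (by positivity : (0 : ℝ) ≤ (m : ℝ) ^ 2)]
  calc |S T ω| / T ≤ (|S (m ^ 2) ω| + 2 * m * C) / (m : ℝ) ^ 2 := by
        gcongr
    _ = |S (m ^ 2) ω| / (m : ℝ) ^ 2 + 2 * C / m := by
        field_simp

end LawOfLargeNumbers

/-! ### Time averages of functionals with mean zero from every window -/

section MarkovAverages

variable {n N : ℕ} [NeZero N] {D : DefaultStrategy n} {κ : ℝ≥0}
  {s : Fin N → AttachmentMethod n} {E : Finset (Window n)}

theorem measurable_shift {α : Type*} [MeasurableSpace α] (t : ℕ) :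
    Measurable fun (ω : ℕ → α) i => ω (t + i) :=
  measurable_pi_lambda _ fun _ => measurable_pi_apply _

/-- If `Z` has mean zero from every initial window, then the future `Z` is orthogonal to the
past. -/
theorem integral_mul_shift_eq_zero
    (hE : ∀ x ∈ E, ∀ z, recordLaw D κ s x z ≠ 0 → z.next ∈ E)
    {Z : (ℕ → Record n N) → ℝ} {C : ℝ} (hZ : Measurable Z) (hC : ∀ ω, |Z ω| ≤ C)
    (hmean : ∀ x ∈ E, ∫ ω, Z ω ∂(tangleLaw D κ s x) = 0) (t : ℕ) :
    ∀ x ∈ E, ∀ (G : (ℕ → Record n N) → ℝ) (B : ℝ), (∀ ω, |G ω| ≤ B) →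
      DependsOn G (Set.Iio t) →
      ∫ ω, G ω * Z (fun i => ω (t + i)) ∂(tangleLaw D κ s x) = 0 := by
  induction t with
  | zero =>
    intro x hx G B hB hG
    obtain ⟨ω₀⟩ : Nonempty (ℕ → Record n N) :=
      nonempty_of_isProbabilityMeasure (tangleLaw D κ s x)
    have : ∀ ω, G ω = G ω₀ := fun ω => hG fun i hi => absurd hi (by simp)
    simp_rw [this, zero_add]
    rw [integral_const_mul, hmean x hx, mul_zero]
  | succ t ih =>
    intro x hx G B hB hG
    have hC0 : ∀ ω, |G ω * Z (fun i => ω (t + 1 + i))| ≤ B * C := fun ω => by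
      rw [abs_mul]
      exact mul_le_mul (hB ω) (hC _) (abs_nonneg _) ((abs_nonneg _).trans (hB ω))
    have hm : Measurable fun ω => G ω * Z (fun i => ω (t + 1 + i)) :=
      (measurable_of_dependsOn_Iio hG).mul (hZ.comp (measurable_shift _))
    rw [integral_tangleLaw D κ s x hm hC0]
    refine Finset.sum_eq_zero fun z _ => ?_
    by_cases hz : recordLaw D κ s x z = 0
    · simp [hz]
    -- Once the first record is fixed, `G` depends on one coordinate fewer and the evolution
    -- restarts from a window in `E`.
    · have := ih z.next (hE x hx z hz) (fun ω => G (consSeq z ω)) B (fun ω => hB _)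
        (dependsOn_comp_consSeq hG z)
      refine mul_eq_zero_of_right _ (Eq.trans ?_ this)
      refine integral_congr_ae (ae_of_all _ fun ω => ?_)
      simp only [Nat.add_right_comm t 1, consSeq_succ]

/-- If `a + L ≤ b`, the functional shifted by `a` reads only records before time `b`, so it is
orthogonal to the one shifted by `b`. -/
theorem tendsto_average_shift
    (hE : ∀ x ∈ E, ∀ z, recordLaw D κ s x z ≠ 0 → z.next ∈ E)
    {Z : (ℕ → Record n N) → ℝ} {C : ℝ} {L : ℕ} (hZ : DependsOn Z (Set.Iio L))
    (hC : ∀ ω, |Z ω| ≤ C) (hmean : ∀ x ∈ E, ∫ ω, Z ω ∂(tangleLaw D κ s x) = 0)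
    {x : Window n} (hx : x ∈ E) :
    ∀ᵐ ω ∂(tangleLaw D κ s x),
      Tendsto (fun T : ℕ => (∑ t ∈ Finset.range T, Z (fun i => ω (t + i))) / T) atTop (𝓝 0) := by
  have hZm := measurable_of_dependsOn_Iio hZ
  refine tendsto_average_of_orthogonal (L := L) (fun t => hZm.comp (measurable_shift t))
    (fun t ω => hC _) fun a b hab => ?_
  refine integral_mul_shift_eq_zero hE hZm hC hmean b x hx (fun ω => Z fun i => ω (a + i)) C
    (fun ω => hC _) fun ω ω' h => hZ fun i hi => h _ ?_
  have := Set.mem_Iio.mp hi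
  exact Set.mem_Iio.mpr (by omega)

end MarkovAverages

/-! ### The Poisson equation for finite stochastic matrices -/

section PoissonEquation

variable {ι : Type*} [Fintype ι]

theorem pow_rowSum_eq_one [DecidableEq ι] {P : Matrix ι ι ℝ} (h1 : ∀ i, ∑ j, P i j = 1) (k : ℕ)
    (i : ι) : ∑ j, (P ^ k) i j = 1 := by
  induction k generalizing i with
  | zero => simp [Matrix.one_apply]
  | succ k ih =>
    simp_rw [pow_succ, Matrix.mul_apply]
    rw [Finset.sum_comm]
    simp_rw [← Finset.mul_sum, h1, mul_one, ih]

theorem pow_nonneg_of_nonneg [DecidableEq ι] {P : Matrix ι ι ℝ} (h0 : ∀ i j, 0 ≤ P i j) (k : ℕ)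
    (i j : ι) : 0 ≤ (P ^ k) i j := by
  induction k generalizing j with
  | zero =>
    rw [pow_zero, Matrix.one_apply]
    split_ifs <;> norm_num
  | succ k ih =>
    rw [pow_succ, Matrix.mul_apply]
    exact Finset.sum_nonneg fun l _ => mul_nonneg (ih l) (h0 l j)

/-- Carries the positive entries of powers of the fixed `P₀` over to every dominating `P`, with
constants that do not depend on `P`. -/
theorem pow_le_pow_of_entrywise [DecidableEq ι] {P P₀ : Matrix ι ι ℝ} {a : ℝ} (ha : 0 ≤ a)
    (h0 : ∀ i j, 0 ≤ P₀ i j) (hP : ∀ i j, a * P₀ i j ≤ P i j) (k : ℕ) (i j : ι) :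
    a ^ k * (P₀ ^ k) i j ≤ (P ^ k) i j := by
  have h0' : ∀ i j, 0 ≤ P i j := fun i j => (mul_nonneg ha (h0 i j)).trans (hP i j)
  induction k generalizing j with
  | zero => simp
  | succ k ih =>
    rw [pow_succ P, pow_succ P₀, Matrix.mul_apply, Matrix.mul_apply, Finset.mul_sum]
    refine Finset.sum_le_sum fun l _ => ?_
    calc a ^ (k + 1) * ((P₀ ^ k) i l * P₀ l j) = (a ^ k * (P₀ ^ k) i l) * (a * P₀ l j) := by ring
      _ ≤ (P ^ k) i l * P l j :=
        mul_le_mul (ih l) (hP l j) (mul_nonneg ha (h0 l j)) (pow_nonneg_of_nonneg h0' k i l)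

theorem abs_mulVec_le {P : Matrix ι ι ℝ} (h0 : ∀ i j, 0 ≤ P i j) (h1 : ∀ i, ∑ j, P i j = 1)
    {f : ι → ℝ} {b : ℝ} (hf : ∀ i, |f i| ≤ b) (i : ι) : |P.mulVec f i| ≤ b := by
  calc |P.mulVec f i| ≤ ∑ j, |P i j * f j| := Finset.abs_sum_le_sum_abs _ _
    _ ≤ ∑ j, P i j * b := Finset.sum_le_sum fun j _ => by
        rw [abs_mul, abs_of_nonneg (h0 i j)]
        exact mul_le_mul_of_nonneg_left (hf j) (h0 i j)
    _ = b := by rw [← Finset.sum_mul, h1, one_mul]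

/-- Telescoping: `g - P ^ k g` is the sum of `P ^ l (g - P g)` over `l < k`, and stochastic matrices
contract the sup norm. -/
theorem abs_sub_pow_mulVec_le [DecidableEq ι] {P : Matrix ι ι ℝ} (h0 : ∀ i j, 0 ≤ P i j)
    (h1 : ∀ i, ∑ j, P i j = 1) {g : ι → ℝ} {b : ℝ} (hg : ∀ i, |g i - P.mulVec g i| ≤ b) (k : ℕ)
    (i : ι) : |g i - (P ^ k).mulVec g i| ≤ k * b := by
  induction k with
  | zero => simp
  | succ k ih =>
    have h : g i - (P ^ (k + 1)).mulVec g i =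
        (g i - (P ^ k).mulVec g i) + (P ^ k).mulVec (fun j => g j - P.mulVec g j) i := by
      have : (fun j => g j - P.mulVec g j) = g - P.mulVec g := rfl
      rw [this, Matrix.mulVec_sub, Matrix.mulVec_mulVec, ← pow_succ, Pi.sub_apply]
      ring
    rw [h]
    refine (abs_add_le _ _).trans ?_
    have := abs_mulVec_le (pow_nonneg_of_nonneg h0 k) (pow_rowSum_eq_one h1 k) hg i
    push_cast
    linarith

/-- A bound on the oscillation of the solutions of the Poisson equation that is uniform over the
stochastic matrices that dominate a fixed irreducible one. -/
theorem exists_oscillation_bound [DecidableEq ι] {P₀ : Matrix ι ι ℝ} (hP₀ : P₀.IsIrreducible)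
    {a : ℝ} (ha : 0 < a) :
    ∃ K : ℝ, 0 ≤ K ∧ ∀ P : Matrix ι ι ℝ, (∀ i j, a * P₀ i j ≤ P i j) → (∀ i, ∑ j, P i j = 1) →
      ∀ (g : ι → ℝ) (b : ℝ), (∀ i, |g i - P.mulVec g i| ≤ b) → ∀ i j, g i - g j ≤ K * b := by
  choose k hk hpos using (Matrix.isIrreducible_iff_exists_pow_pos hP₀.nonneg).mp hP₀
  set c : ι → ι → ℝ := fun i j => k i j / (a ^ k i j * (P₀ ^ k i j) i j) with hc
  have hc0 : ∀ i j, 0 ≤ c i j := fun i j =>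
    div_nonneg (Nat.cast_nonneg _) (mul_nonneg (pow_nonneg ha.le _) (hpos i j).le)
  refine ⟨∑ i, ∑ j, c i j, Finset.sum_nonneg fun i _ => Finset.sum_nonneg fun j _ => hc0 i j, ?_⟩
  intro P hP h1 g b hg i j
  have h0 : ∀ i j, 0 ≤ P i j := fun i j => (mul_nonneg ha.le (hP₀.nonneg i j)).trans (hP i j)
  have hb : 0 ≤ b := (abs_nonneg _).trans (hg i)
  obtain ⟨m, -, hm⟩ := Finset.exists_min_image Finset.univ g ⟨i, Finset.mem_univ i⟩
  have hm' : ∀ l, 0 ≤ g l - g m := fun l => sub_nonneg.mpr (hm l (Finset.mem_univ l))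
  have hδ : 0 < a ^ k m i * (P₀ ^ k m i) m i := mul_pos (pow_pos ha _) (hpos m i)
  -- As `m` minimises `g`, all terms of `∑ l, (P ^ k) m l * (g l - g m)` are nonnegative, so the
  -- term `l = i` is at most the sum, which telescoping bounds by `k * b`.
  have hstep : a ^ k m i * (P₀ ^ k m i) m i * (g i - g m) ≤ k m i * b := by
    calc a ^ k m i * (P₀ ^ k m i) m i * (g i - g m) ≤ (P ^ k m i) m i * (g i - g m) :=
          mul_le_mul_of_nonneg_right
            (pow_le_pow_of_entrywise ha.le hP₀.nonneg hP _ _ _) (hm' i)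
      _ ≤ ∑ l, (P ^ k m i) m l * (g l - g m) :=
          Finset.single_le_sum (f := fun l => (P ^ k m i) m l * (g l - g m))
            (fun l _ => mul_nonneg (pow_nonneg_of_nonneg h0 _ _ _) (hm' l)) (Finset.mem_univ i)
      _ = (P ^ k m i).mulVec g m - g m := by
          simp_rw [mul_sub, Finset.sum_sub_distrib, ← Finset.sum_mul, pow_rowSum_eq_one h1, one_mul]
          rfl
      _ ≤ k m i * b := by
          have := (abs_le.mp (abs_sub_pow_mulVec_le h0 h1 hg (k m i) m)).1
          linarith
  have hle : g i - g m ≤ c m i * b := by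
    rw [hc]
    simp only
    rw [div_mul_eq_mul_div, le_div_iff₀ hδ]
    linarith
  have hcs : c m i ≤ ∑ i, ∑ j, c i j :=
    (Finset.single_le_sum (f := fun j => c m j) (fun j _ => hc0 m j) (Finset.mem_univ i)).trans
      (Finset.single_le_sum (f := fun i => ∑ j, c i j)
        (fun i _ => Finset.sum_nonneg fun j _ => hc0 i j) (Finset.mem_univ m))
  calc g i - g j ≤ g i - g m := by linarith [hm' j]
    _ ≤ c m i * b := hle
    _ ≤ _ := mul_le_mul_of_nonneg_right hcs hb

/-- The maximum principle: the constant in the Poisson equation is bounded by the right-hand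
side. -/
theorem abs_const_le_of_poisson [Nonempty ι] {P : Matrix ι ι ℝ} (h0 : ∀ i j, 0 ≤ P i j)
    (h1 : ∀ i, ∑ j, P i j = 1) {f g : ι → ℝ} {c b : ℝ}
    (h : ∀ i, f i - c = g i - P.mulVec g i) (hf : ∀ i, |f i| ≤ b) : |c| ≤ b := by
  -- `g - P g` is nonpositive at a minimum of `g` and nonnegative at a maximum, whence `f m ≤ c ≤ f
  -- M`.
  obtain ⟨m, -, hm⟩ := Finset.exists_min_image Finset.univ g Finset.univ_nonempty
  obtain ⟨M, -, hM⟩ := Finset.exists_max_image Finset.univ g Finset.univ_nonempty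
  have hle : g m ≤ P.mulVec g m := by
    calc g m = ∑ j, P m j * g m := by rw [← Finset.sum_mul, h1, one_mul]
      _ ≤ _ := Finset.sum_le_sum fun j hj => mul_le_mul_of_nonneg_left (hm j hj) (h0 m j)
  have hge : P.mulVec g M ≤ g M := by
    calc P.mulVec g M ≤ ∑ j, P M j * g M :=
          Finset.sum_le_sum fun j hj => mul_le_mul_of_nonneg_left (hM j hj) (h0 M j)
      _ = g M := by rw [← Finset.sum_mul, h1, one_mul]
  have := h m
  have := h M
  have := abs_le.mp (hf m)
  have := abs_le.mp (hf M)
  exact abs_le.mpr ⟨by linarith, by linarith⟩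

theorem exists_poisson [DecidableEq ι] [Nonempty ι] {P₀ P : Matrix ι ι ℝ}
    (hP₀ : P₀.IsIrreducible) {a : ℝ} (ha : 0 < a) (hP : ∀ i j, a * P₀ i j ≤ P i j)
    (h1 : ∀ i, ∑ j, P i j = 1) (f : ι → ℝ) :
    ∃ (c : ℝ) (g : ι → ℝ), ∀ i, f i - c = g i - P.mulVec g i := by
  have h0 : ∀ i j, 0 ≤ P i j := fun i j => (mul_nonneg ha.le (hP₀.nonneg i j)).trans (hP i j)
  obtain ⟨K, -, hK⟩ := exists_oscillation_bound hP₀ ha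
  obtain ⟨i₀⟩ := ‹Nonempty ι›
  -- `1 - P` kills constants; adding evaluation at `i₀` makes it injective, hence surjective in
  -- finite dimension. If `T g = f`, the constant is `c = g i₀`. In the kernel, the maximum
  -- principle forces `g i₀ = 0`, and the oscillation bound with `b = 0` makes `g` constant.
  let T : (ι → ℝ) →ₗ[ℝ] (ι → ℝ) :=
    LinearMap.id - P.mulVecLin + (LinearMap.pi fun _ => LinearMap.proj i₀)
  have hT : ∀ g i, T g i = g i - P.mulVec g i + g i₀ := fun g i => rfl
  have hinj : Function.Injective T := by
    rw [← LinearMap.ker_eq_bot, LinearMap.ker_eq_bot']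
    intro g hg
    have hg' : ∀ i, (0 : ι → ℝ) i - g i₀ = g i - P.mulVec g i := fun i => by
      have := hT g i
      rw [hg] at this
      simp only [Pi.zero_apply] at this ⊢
      linarith
    have hc : g i₀ = 0 := abs_nonpos_iff.mp
      (abs_const_le_of_poisson (b := 0) h0 h1 hg' fun i => by simp)
    have hosc := hK P hP h1 g 0 fun i => by rw [← hg' i, hc]; simp
    funext i
    have h2 := hosc i i₀
    have h3 := hosc i₀ i
    simp only [Pi.zero_apply]
    linarith
  obtain ⟨g, hg⟩ := (LinearMap.injective_iff_surjective.mp hinj) f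
  refine ⟨g i₀, g, fun i => ?_⟩
  rw [← hg, hT]
  ring

end PoissonEquation

/-! ### Averages along a random subsequence of times -/

section Subsequence

theorem sum_range_ite_eq_sum_nth (p : ℕ → Prop) [DecidablePred p] (f : ℕ → ℝ) (T : ℕ) :
    (∑ t ∈ Finset.range T, if p t then f t else 0) =
      ∑ j ∈ Finset.range (Nat.count p T), f (Nat.nth p j) := by
  induction T with
  | zero => simp
  | succ T ih =>
    rw [Finset.sum_range_succ, ih, Nat.count_succ]
    by_cases h : p T
    · rw [if_pos h, if_pos h, Finset.sum_range_succ, Nat.nth_count h]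
    · rw [if_neg h, if_neg h, add_zero, add_zero]

/-- Averages along a set of times of positive density. -/
theorem tendsto_average_nth {p : ℕ → Prop} [DecidablePred p] {f : ℕ → ℝ} {w c : ℝ} (hw : 0 < w)
    (hp : Tendsto (fun T : ℕ => (∑ t ∈ Finset.range T, if p t then (1 : ℝ) else 0) / T)
      atTop (𝓝 w))
    (hf : Tendsto (fun T : ℕ => (∑ t ∈ Finset.range T, if p t then f t else 0) / T)
      atTop (𝓝 (w * c))) :
    {t | p t}.Infinite ∧
      Tendsto (fun m : ℕ => (∑ j ∈ Finset.range m, f (Nat.nth p j)) / m) atTop (𝓝 c) := by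
  have hinf : {t | p t}.Infinite := by
    intro hfin
    have h0 : Tendsto (fun T : ℕ => (∑ t ∈ Finset.range T, if p t then (1 : ℝ) else 0) / T)
        atTop (𝓝 0) := by
      refine squeeze_zero (fun T => div_nonneg (Finset.sum_nonneg fun t _ => ?_) T.cast_nonneg)
        (fun T => ?_) (tendsto_const_div_atTop_nhds_zero_nat (hfin.toFinset.card : ℝ))
      · split_ifs <;> norm_num
      · refine div_le_div_of_nonneg_right ?_ T.cast_nonneg
        rw [← Finset.sum_filter, Finset.sum_const, nsmul_eq_mul, mul_one]
        refine Nat.cast_le.mpr (Finset.card_le_card fun t ht => ?_)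
        simpa using (Finset.mem_filter.mp ht).2
    exact hw.ne' (tendsto_nhds_unique hp h0)
  refine ⟨hinf, ?_⟩
  -- Both averages are evaluated at `T = Nat.nth p m`, before which exactly `m` times satisfy `p`;
  -- in their quotient `T` cancels.
  have hT : Tendsto (Nat.nth p) atTop atTop := (Nat.nth_strictMono hinf).tendsto_atTop
  have h1 := hp.comp hT
  have h2 := hf.comp hT
  have h3 := h2.div h1 hw.ne'
  rw [mul_div_cancel_left₀ c hw.ne'] at h3
  refine h3.congr' ?_
  filter_upwards [eventually_gt_atTop 0] with m hm
  have hpos : (0 : ℝ) < Nat.nth p m := by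
    have : m ≤ Nat.nth p m := (Nat.nth_strictMono hinf).le_apply
    exact_mod_cast hm.trans_le this
  simp only [Function.comp_apply, Pi.div_apply]
  rw [sum_range_ite_eq_sum_nth, sum_range_ite_eq_sum_nth, Nat.count_nth_of_infinite hinf,
    div_div_div_cancel_right₀ hpos.ne']
  simp

end Subsequence

/-! ### Shift invariance and locality of the cost -/

section Cost

variable {n N : ℕ}

theorem Approves.lt {ω : ℕ → Record n N} {t u : ℕ} (h : Approves ω t u) : u < t := by
  rcases h with h | h <;> omega

theorem References.lt {ω : ℕ → Record n N} {t u : ℕ} (h : References ω t u) : u < t := by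
  induction h with
  | single h => exact h.lt
  | tail _ h ih => exact h.lt.trans ih

theorem approves_shift {ω : ℕ → Record n N} {v a b : ℕ} :
    Approves (fun i => ω (v + i)) a b ↔ Approves ω (v + a) (v + b) := by
  simp only [Approves]
  omega

/-- Edges go back in time, so every vertex on a path ending at `v + b` is at least `v` and has a
preimage under the shift. -/
theorem references_shift {ω : ℕ → Record n N} {v a b : ℕ} :
    References (fun i => ω (v + i)) a b ↔ References ω (v + a) (v + b) := by
  refine ⟨fun h => Relation.TransGen.lift (fun i => v + i) (fun _ _ => approves_shift.mp) _ _ h,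
    fun h => ?_⟩
  suffices ∀ u, References ω u (v + b) → ∀ a, u = v + a → References (fun i => ω (v + i)) a b from
    this _ h a rfl
  intro u hu
  induction hu using Relation.TransGen.head_induction_on with
  | single h =>
    rintro a rfl
    exact .single (approves_shift.mpr h)
  | head h hcb ih =>
    rintro a rfl
    have hlt := References.lt hcb
    obtain ⟨c, rfl⟩ := Nat.exists_eq_add_of_le ((Nat.le_add_right v b).trans hlt.le)
    exact .head (approves_shift.mpr h) (ih c rfl)

theorem walkReferences_shift {ω : ℕ → Record n N} {v k : ℕ} :
    WalkReferences (fun i => ω (v + i)) k 0 ↔ WalkReferences ω (v + k) v := by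
  constructor
  · rintro ⟨u, hu, h⟩
    simp only at hu
    exact ⟨v + u, by omega, references_shift.mp h⟩
  · rintro ⟨u, hu, h⟩
    obtain ⟨a, rfl⟩ := Nat.exists_eq_add_of_le h.lt.le
    exact ⟨a, by simp only; omega, references_shift.mpr h⟩

theorem W_shift (M : ℕ) (ω : ℕ → Record n N) (v : ℕ) : W M (fun i => ω (v + i)) 0 = W M ω v := by
  refine Finset.sum_congr rfl fun k _ => ?_
  rw [zero_add]
  classical
  exact if_congr walkReferences_shift rfl rfl

/-- Record `0` is never read: a transaction with an outgoing edge in the path has a positive number.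
-/
theorem References.congr {ω ω' : ℕ → Record n N} {T : ℕ} (h : ∀ i ∈ Set.Icc 1 T, ω i = ω' i)
    {u v : ℕ} (hu : u ≤ T) (hr : References ω u v) : References ω' u v := by
  induction hr using Relation.TransGen.head_induction_on with
  | single ha =>
    refine .single ?_
    unfold Approves
    rwa [← h _ ⟨by have := ha.lt; omega, hu⟩]
  | head ha _ ih =>
    refine .head ?_ (ih (ha.lt.le.trans hu))
    unfold Approves
    rwa [← h _ ⟨by have := ha.lt; omega, hu⟩]

theorem WalkReferences.congr {ω ω' : ℕ → Record n N} {T : ℕ} (h : ∀ i ∈ Set.Icc 1 T, ω i = ω' i)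
    {t v : ℕ} (ht : t ≤ T) (hr : WalkReferences ω t v) : WalkReferences ω' t v := by
  obtain ⟨u, hu, hr⟩ := hr
  refine ⟨u, ?_, hr.congr h (by omega)⟩
  rwa [← h t ⟨by omega, ht⟩]

theorem dependsOn_W (M : ℕ) :
    DependsOn (fun ω : ℕ → Record n N => W M ω 0) (Set.Icc 1 M) := by
  intro ω ω' h
  refine Finset.sum_congr rfl fun k hk => ?_
  have hk := (Finset.mem_Icc.mp hk).2
  have : WalkReferences ω (0 + k) 0 ↔ WalkReferences ω' (0 + k) 0 :=
    ⟨fun hr => hr.congr h (by omega), fun hr => hr.congr (fun i hi => (h i hi).symm) (by omega)⟩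
  classical
  exact if_congr this rfl rfl

theorem W_le (M : ℕ) (ω : ℕ → Record n N) (v : ℕ) : W M ω v ≤ M := by
  unfold W
  refine (Finset.sum_le_card_nsmul _ _ 1 fun k _ => ?_).trans ?_
  · split_ifs <;> norm_num
  · simp

theorem abs_W_le (M : ℕ) (ω : ℕ → Record n N) (v : ℕ) : |(W M ω v : ℝ)| ≤ M := by
  rw [abs_of_nonneg (Nat.cast_nonneg _)]
  exact_mod_cast W_le M ω v

/-- The number of walks missing the transaction that precedes the records `ω`. -/
noncomputable def missed (M : ℕ) (ω : ℕ → Record n N) : ℝ := W M (consSeq (ω 0) ω) 0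

/-- The `ω 0` prepended in `missed` is a dummy, since `W M _ 0` ignores record `0`. -/
theorem W_consSeq (M : ℕ) (z : Record n N) (ω : ℕ → Record n N) :
    (W M (consSeq z ω) 0 : ℝ) = missed M ω := by
  refine congrArg Nat.cast (dependsOn_W M fun i hi => ?_)
  obtain ⟨j, rfl⟩ := Nat.exists_eq_succ_of_ne_zero (by have := hi.1; omega : i ≠ 0)
  rfl

theorem dependsOn_missed (M : ℕ) :
    DependsOn (missed M : (ℕ → Record n N) → ℝ) (Set.Iio M) := by
  intro ω ω' h
  refine congrArg Nat.cast (dependsOn_W M fun i hi => ?_)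
  obtain ⟨j, rfl⟩ := Nat.exists_eq_succ_of_ne_zero (by have := hi.1; omega : i ≠ 0)
  exact h j (Set.mem_Iio.mpr (by have := hi.2; omega))

theorem abs_missed_le (M : ℕ) (ω : ℕ → Record n N) : |missed M ω| ≤ M := abs_W_le _ _ _

end Cost

/-! ### Expectations with respect to a single record -/

section RecordLaw

variable {n N : ℕ} [NeZero N] (D : DefaultStrategy n) (κ : ℝ≥0)
  (s : Fin N → AttachmentMethod n)

theorem recordLaw_apply (x : Window n) (z : Record n N) [Decidable (z.window = x)] :
    recordLaw D κ s x z = if z.window = x then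
      issuerLaw κ N z.issuer * (methodOf D s z.issuer x z.approved * D.exit x z.endpoint)
      else 0 := by
  classical
  obtain ⟨y, o, p, e⟩ := z
  simp only [recordLaw, PMF.bind_apply, PMF.map_apply, tsum_fintype, Record.mk.injEq]
  split_ifs with h
  · subst h
    rw [Finset.sum_eq_single o, Finset.sum_eq_single p, Finset.sum_eq_single e]
    · simp
    · intro b _ hb
      simp [Ne.symm hb]
    · simp
    · intro b _ hb
      simp [Ne.symm hb]
    · simp
    · intro b _ hb
      simp [Ne.symm hb]
    · simp
  · simp [h]

theorem toReal_issuerLaw (o : Option (Fin N)) : (issuerLaw κ N o).toReal = issuerWeight κ N o := by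
  simp [issuerLaw]

theorem sum_toReal_pmf {α : Type*} [Fintype α] (p : PMF α) : ∑ a, (p a).toReal = 1 := by
  rw [← ENNReal.toReal_sum fun a _ => p.apply_ne_top a,
    ← tsum_fintype (L := .unconditional _) (p ·), p.tsum_coe,
    ENNReal.toReal_one]

theorem sum_recordLaw (x : Window n) (φ : Record n N → ℝ) :
    ∑ z, (recordLaw D κ s x z).toReal * φ z =
      ∑ o, (issuerWeight κ N o : ℝ) * ∑ p, (methodOf D s o x p).toReal *
        ∑ e, (D.exit x e).toReal * φ ⟨x, o, p, e⟩ := by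
  classical
  rw [← (recordEquiv n N).symm.sum_comp]
  simp_rw [Fintype.sum_prod_type (α₁ := Window n), recordLaw_apply]
  rw [Finset.sum_eq_single x]
  · rw [Fintype.sum_prod_type]
    refine Finset.sum_congr rfl fun o _ => ?_
    rw [Finset.mul_sum, Fintype.sum_prod_type]
    refine Finset.sum_congr rfl fun p _ => ?_
    rw [Finset.mul_sum, Finset.mul_sum]
    refine Finset.sum_congr rfl fun e _ => ?_
    simp only [recordEquiv, Equiv.coe_fn_symm_mk, if_true, ENNReal.toReal_mul, toReal_issuerLaw]
    ring
  · intro y _ hy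
    refine Finset.sum_eq_zero fun q _ => ?_
    simp [recordEquiv, hy]
  · simp

theorem sum_recordLaw_of_approved (x : Window n) (φ : Option (Fin N) → Fin n × Fin n → ℝ) :
    ∑ z, (recordLaw D κ s x z).toReal * φ z.issuer z.approved =
      ∑ o, (issuerWeight κ N o : ℝ) * ∑ p, (methodOf D s o x p).toReal * φ o p := by
  rw [sum_recordLaw]
  simp_rw [← Finset.sum_mul, sum_toReal_pmf, one_mul]

theorem sum_recordLaw_window (x : Window n) (φ : Window n → ℝ) :
    ∑ z, (recordLaw D κ s x z).toReal * φ z.window = φ x := by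
  classical
  rw [← one_mul (φ x), ← sum_toReal_pmf (recordLaw D κ s x), Finset.sum_mul]
  refine Finset.sum_congr rfl fun z _ => ?_
  rw [recordLaw_apply]
  split_ifs with h
  · rw [h]
  · simp

theorem recordLaw_next_mem {E : Finset (Window n)} (hD : ClosedUnder E D.attach)
    (hs : ∀ k, ClosedUnder E (s k)) {x : Window n} (hx : x ∈ E) {z : Record n N}
    (hz : recordLaw D κ s x z ≠ 0) : z.next ∈ E := by
  classical
  rw [recordLaw_apply] at hz
  split_ifs at hz with h
  · have hp : methodOf D s z.issuer x z.approved ≠ 0 :=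
      left_ne_zero_of_mul (right_ne_zero_of_mul hz)
    unfold Record.next
    rw [h]
    cases ho : z.issuer with
    | none =>
      rw [ho] at hp
      exact hD x hx _ ((PMF.mem_support_iff _ _).mpr hp)
    | some k =>
      rw [ho] at hp
      exact hs k x hx _ ((PMF.mem_support_iff _ _).mpr hp)
  · exact absurd rfl hz

theorem integral_tangleLaw_zero (x : Window n) (φ : Record n N → ℝ) :
    ∫ ω, φ (ω 0) ∂(tangleLaw D κ s x) = ∑ z, (recordLaw D κ s x z).toReal * φ z := by
  rw [integral_tangleLaw D κ s x (F := fun ω => φ (ω 0))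
    ((Measurable.of_discrete (f := φ)).comp (measurable_pi_apply 0)) (C := ∑ z, |φ z|)
    (fun ω => Finset.single_le_sum (f := fun z => |φ z|) (fun _ _ => abs_nonneg _)
      (Finset.mem_univ (ω 0)))]
  simp

end RecordLaw

/-! ### The mean cost as the constant of a Poisson equation -/

section MeanCost

variable {n N : ℕ} [NeZero N] (D : DefaultStrategy n) (κ : ℝ≥0) (M : ℕ)
  (s : Fin N → AttachmentMethod n)

/-- The expected number of walks missing a transaction after whose attachment the window
is `y`. -/
noncomputable def futureCost (y : Window n) : ℝ := ∫ ω, missed M ω ∂(tangleLaw D κ s y)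

/-- The expected number of walks missing a transaction that is attached to the window `x` by the
method `S`. -/
noncomputable def expectedCost (S : AttachmentMethod n) (x : Window n) : ℝ :=
  ∑ p, (S x p).toReal * futureCost D κ M s (x.attach p)

/-- The expectation of `g` after one step of the window chain. -/
noncomputable def stepMean (g : Window n → ℝ) (x : Window n) : ℝ :=
  ∑ z, (recordLaw D κ s x z).toReal * g z.next

theorem abs_futureCost_le (y : Window n) : |futureCost D κ M s y| ≤ M := by
  refine (norm_integral_le_of_norm_le_const (μ := tangleLaw D κ s y)
    (ae_of_all _ fun ω => (Real.norm_eq_abs _).le.trans (abs_missed_le M ω))).trans ?_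
  simp

theorem abs_sum_pmf_mul_le {α : Type*} [Fintype α] (p : PMF α) {f : α → ℝ} {b : ℝ}
    (hf : ∀ a, |f a| ≤ b) : |∑ a, (p a).toReal * f a| ≤ b := by
  calc |∑ a, (p a).toReal * f a| ≤ ∑ a, |(p a).toReal * f a| := Finset.abs_sum_le_sum_abs _ _
    _ ≤ ∑ a, (p a).toReal * b := Finset.sum_le_sum fun a _ => by
        rw [abs_mul, abs_of_nonneg ENNReal.toReal_nonneg]
        exact mul_le_mul_of_nonneg_left (hf a) ENNReal.toReal_nonneg
    _ = b := by rw [← Finset.sum_mul, sum_toReal_pmf, one_mul]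

theorem abs_expectedCost_le (S : AttachmentMethod n) (x : Window n) :
    |expectedCost D κ M s S x| ≤ M :=
  abs_sum_pmf_mul_le _ fun _ => abs_futureCost_le D κ M s _

theorem issuerWeight_some_pos (k : Fin N) : (0 : ℝ) < issuerWeight κ N (some k) := by
  have hN : (0 : ℝ≥0) < N := Nat.cast_pos.mpr (NeZero.pos N)
  have : 0 < issuerWeight κ N (some k) := by
    unfold issuerWeight
    positivity
  exact_mod_cast this

theorem recordLaw_window {x : Window n} {z : Record n N} (hz : recordLaw D κ s x z ≠ 0) :
    z.window = x := by
  classical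
  rw [recordLaw_apply] at hz
  by_contra h
  exact hz (if_neg h)

theorem sum_recordLaw_issuer (k : Fin N) (x : Window n) (φ : Fin n × Fin n → ℝ) :
    ∑ z, (recordLaw D κ s x z).toReal * (if z.issuer = some k then φ z.approved else 0) =
      issuerWeight κ N (some k) * ∑ p, (s k x p).toReal * φ p := by
  rw [sum_recordLaw_of_approved D κ s x fun o p => if o = some k then φ p else 0,
    Finset.sum_eq_single (some k)]
  · simp [methodOf]
  · intro o _ ho
    simp [ho]
  · simp

/-- Given the first record, the missed walks depend only on the later ones, whose law sees the first
record through the next window alone; the issuer's weight therefore factors out. -/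
theorem integral_issued_cost (k : Fin N) (x : Window n) :
    ∫ ω, (if (ω 0).issuer = some k then (W M ω 0 : ℝ) else 0) ∂(tangleLaw D κ s x) =
      issuerWeight κ N (some k) * expectedCost D κ M s (s k) x := by
  have hdep : DependsOn (fun ω : ℕ → Record n N =>
      if (ω 0).issuer = some k then (W M ω 0 : ℝ) else 0) (Set.Iio (M + 1)) := by
    intro ω ω' h
    have h1 : W M ω 0 = W M ω' 0 := dependsOn_W M fun i hi =>
      h i (Set.mem_Iio.mpr (Nat.lt_succ_of_le hi.2))
    simp only [h 0 (Set.mem_Iio.mpr M.succ_pos), h1]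
  rw [integral_tangleLaw D κ s x (measurable_of_dependsOn_Iio hdep) (C := M) fun ω => by
    split_ifs
    · exact abs_W_le _ _ _
    · simp]
  rw [expectedCost, ← sum_recordLaw_issuer D κ s]
  refine Finset.sum_congr rfl fun z _ => ?_
  by_cases hz : recordLaw D κ s x z = 0
  · simp [hz]
  · rw [← recordLaw_window D κ s hz]
    congr 1
    simp only [consSeq_zero, W_consSeq]
    split_ifs
    · rfl
    · simp

theorem integral_window_one (x : Window n) (g : Window n → ℝ) :
    ∫ ω, g (ω 1).window ∂(tangleLaw D κ s x) = stepMean D κ s g x := by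
  rw [integral_tangleLaw D κ s x (F := fun ω => g (ω 1).window)
    ((Measurable.of_discrete (f := fun z : Record n N => g z.window)).comp (measurable_pi_apply 1))
    (C := ∑ y, |g y|) (fun ω => Finset.single_le_sum (f := fun y => |g y|)
      (fun _ _ => abs_nonneg _) (Finset.mem_univ _))]
  refine Finset.sum_congr rfl fun z _ => ?_
  simp only [consSeq, integral_tangleLaw_zero D κ s z.next (fun z => g z.window),
    sum_recordLaw_window]

theorem tendsto_average_issued {E : Finset (Window n)} (hD : ClosedUnder E D.attach)
    (hs : ∀ i, ClosedUnder E (s i)) (k : Fin N) {x : Window n} (hx : x ∈ E) :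
    ∀ᵐ ω ∂(tangleLaw D κ s x), Tendsto (fun T : ℕ =>
      (∑ t ∈ Finset.range T, if (ω t).issuer = some k then (1 : ℝ) else 0) / T) atTop
      (𝓝 (issuerWeight κ N (some k) : ℝ)) := by
  set w : ℝ := (issuerWeight κ N (some k) : ℝ)
  have hw : 0 ≤ w := NNReal.coe_nonneg _
  let Z : (ℕ → Record n N) → ℝ := fun ω => (if (ω 0).issuer = some k then 1 else 0) - w
  have hZ : DependsOn Z (Set.Iio 1) := fun ω ω' h => by
    simp only [Z, h 0 (Set.mem_Iio.mpr one_pos)]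
  have hC : ∀ ω, |Z ω| ≤ 1 + w := fun ω => by
    refine (abs_sub _ _).trans ?_
    rw [abs_of_nonneg hw]
    refine add_le_add_left ?_ w
    split_ifs <;> norm_num
  have hmean : ∀ x ∈ E, ∫ ω, Z ω ∂(tangleLaw D κ s x) = 0 := fun x _ => by
    rw [integral_tangleLaw_zero D κ s x (fun z => (if z.issuer = some k then (1 : ℝ) else 0) - w)]
    simp_rw [mul_sub, Finset.sum_sub_distrib, ← Finset.sum_mul, sum_toReal_pmf, one_mul]
    rw [sum_recordLaw_issuer D κ s k x fun _ => 1]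
    simp_rw [mul_one, sum_toReal_pmf, mul_one]
    exact sub_self w
  filter_upwards [tendsto_average_shift (fun x hx z hz => recordLaw_next_mem D κ s hD hs hx hz)
    hZ hC hmean hx] with ω hω
  have h := hω.add_const w
  rw [zero_add] at h
  refine h.congr' ?_
  filter_upwards [eventually_gt_atTop 0] with T hT
  have hT' : (T : ℝ) ≠ 0 := by exact_mod_cast hT.ne'
  simp only [Z, add_zero, Finset.sum_sub_distrib, Finset.sum_const, Finset.card_range,
    nsmul_eq_mul]
  field_simp
  ring

/-- A solution of the Poisson equation for the expected cost gives its long-run average. -/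
theorem tendsto_average_cost {E : Finset (Window n)} (hD : ClosedUnder E D.attach)
    (hs : ∀ i, ClosedUnder E (s i)) (k : Fin N) {c : ℝ} {g : Window n → ℝ}
    (hg : ∀ x ∈ E, expectedCost D κ M s (s k) x - c = g x - stepMean D κ s g x)
    {x : Window n} (hx : x ∈ E) :
    ∀ᵐ ω ∂(tangleLaw D κ s x), Tendsto (fun T : ℕ =>
      (∑ t ∈ Finset.range T, if (ω t).issuer = some k then (W M ω t : ℝ) else 0) / T) atTop
      (𝓝 (issuerWeight κ N (some k) * c)) := by
  set w : ℝ := (issuerWeight κ N (some k) : ℝ) with hw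
  obtain ⟨B, hB⟩ : ∃ B, ∀ y, |g y| ≤ B := ⟨∑ y, |g y|, fun y =>
    Finset.single_le_sum (f := fun y => |g y|) (fun _ _ => abs_nonneg _) (Finset.mem_univ y)⟩
  let F : (ℕ → Record n N) → ℝ := fun ω => if (ω 0).issuer = some k then (W M ω 0 : ℝ) else 0
  -- `F` has mean `w * expectedCost`, so `w` times the Poisson equation says that `Z` has mean zero
  -- from every window in `E`. It reads records `0, …, M` through `F` and record `1` through `g`,
  -- which the bound `M + 2` covers even for `M = 0`.
  let Z : (ℕ → Record n N) → ℝ := fun ω =>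
    F ω - w * c + w * g (ω 1).window - w * g (ω 0).window
  have hF : DependsOn F (Set.Iio (M + 2)) := fun ω ω' h => by
    have h1 : W M ω 0 = W M ω' 0 := dependsOn_W M fun i hi =>
      h i (Set.mem_Iio.mpr (by have := hi.2; omega))
    simp only [F, h 0 (Set.mem_Iio.mpr (by omega)), h1]
  have hFb : ∀ ω, |F ω| ≤ M := fun ω => by
    simp only [F]
    split_ifs
    · exact abs_W_le _ _ _
    · simp
  have hZ : DependsOn Z (Set.Iio (M + 2)) := fun ω ω' h => by
    simp only [Z, hF h, h 0 (Set.mem_Iio.mpr (by omega)), h 1 (Set.mem_Iio.mpr (by omega))]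
  have hwB : ∀ y, |w * g y| ≤ |w| * B := fun y => by
    rw [abs_mul]
    exact mul_le_mul_of_nonneg_left (hB y) (abs_nonneg w)
  have hC : ∀ ω, |Z ω| ≤ M + |w * c| + |w| * B + |w| * B := fun ω => by
    refine (abs_sub _ _).trans (add_le_add ((abs_add_le _ _).trans (add_le_add
      ((abs_sub _ _).trans (add_le_add (hFb ω) le_rfl)) (hwB _))) (hwB _))
  have hgm : ∀ i, Measurable fun ω : ℕ → Record n N => g (ω i).window := fun i =>
    (Measurable.of_discrete (f := fun z : Record n N => g z.window)).comp (measurable_pi_apply i)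
  have hmean : ∀ x ∈ E, ∫ ω, Z ω ∂(tangleLaw D κ s x) = 0 := fun x hx => by
    have hFi : Integrable F (tangleLaw D κ s x) :=
      Integrable.of_bound (measurable_of_dependsOn_Iio hF).aestronglyMeasurable M
        (ae_of_all _ hFb)
    have hgi : ∀ i, Integrable (fun ω => w * g (ω i).window) (tangleLaw D κ s x) := fun i =>
      Integrable.of_bound ((hgm i).const_mul w).aestronglyMeasurable (|w| * B)
        (ae_of_all _ fun ω => hwB _)
    have hci : Integrable (fun _ : ℕ → Record n N => w * c) (tangleLaw D κ s x) :=
      integrable_const _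
    have h1 : Integrable (fun ω => F ω - w * c) (tangleLaw D κ s x) := hFi.sub hci
    have h2 : Integrable (fun ω => F ω - w * c + w * g (ω 1).window) (tangleLaw D κ s x) :=
      h1.add (hgi 1)
    simp only [Z]
    rw [integral_sub h2 (hgi 0), integral_add h1 (hgi 1),
      integral_sub hFi hci, integral_const, integral_const_mul, integral_const_mul,
      integral_window_one,
      integral_tangleLaw_zero D κ s x (fun z => g z.window), sum_recordLaw_window,
      integral_issued_cost, ← hw]
    have := hg x hx
    simp only [probReal_univ, one_smul]
    linear_combination w * this
  filter_upwards [tendsto_average_shift (fun x hx z hz => recordLaw_next_mem D κ s hD hs hx hz)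
    hZ hC hmean hx] with ω hω
  -- The corrections telescope to a bounded boundary term.
  have hrem : Tendsto (fun T : ℕ => w * (g (ω 0).window - g (ω T).window) / T) atTop (𝓝 0) := by
    refine squeeze_zero_norm (fun T => ?_)
      (tendsto_const_div_atTop_nhds_zero_nat (|w| * (B + B)))
    rw [norm_div, Real.norm_eq_abs, Real.norm_natCast, abs_mul]
    refine div_le_div_of_nonneg_right (mul_le_mul_of_nonneg_left ?_ (abs_nonneg w)) T.cast_nonneg
    exact (abs_sub _ _).trans (add_le_add (hB _) (hB _))
  have h := (hω.add hrem).add_const (w * c)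
  rw [zero_add, zero_add] at h
  refine h.congr' ?_
  filter_upwards [eventually_gt_atTop 0] with T hT
  have hT' : (T : ℝ) ≠ 0 := by exact_mod_cast hT.ne'
  have htel : ∑ t ∈ Finset.range T, (g (ω (t + 1)).window - g (ω t).window) =
      g (ω T).window - g (ω 0).window := Finset.sum_range_sub (fun t => g (ω t).window) T
  have hsum : ∑ t ∈ Finset.range T, Z (fun i => ω (t + i)) =
      (∑ t ∈ Finset.range T, if (ω t).issuer = some k then (W M ω t : ℝ) else 0) - T * (w * c) +
        w * (g (ω T).window - g (ω 0).window) := by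
    rw [← htel, Finset.mul_sum, ← nsmul_eq_mul, ← Finset.card_range T, ← Finset.sum_const,
      Finset.card_range, ← Finset.sum_sub_distrib, ← Finset.sum_add_distrib]
    refine Finset.sum_congr rfl fun t _ => ?_
    simp only [Z, F, W_shift, add_zero]
    ring
  rw [hsum]
  field_simp
  ring

theorem isMeanCost_of_poisson {E : Finset (Window n)} (hD : ClosedUnder E D.attach)
    (hs : ∀ i, ClosedUnder E (s i)) (k : Fin N) {c : ℝ} {g : Window n → ℝ}
    (hg : ∀ x ∈ E, expectedCost D κ M s (s k) x - c = g x - stepMean D κ s g x) :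
    IsMeanCost E D κ M s k ((M : ℝ)⁻¹ * c) := by
  intro x hx
  filter_upwards [tendsto_average_issued D κ s hD hs k hx,
    tendsto_average_cost D κ M s hD hs k hg hx] with ω h1 h2
  obtain ⟨hinf, hlim⟩ := tendsto_average_nth (p := fun t => (ω t).issuer = some k)
    (f := fun t => (W M ω t : ℝ)) (issuerWeight_some_pos κ k) h1 h2
  exact ⟨hinf, hlim.const_mul _⟩

/-- Two almost sure statements under a probability measure share a trajectory, on which the limit is
unique. -/
theorem meanCost_eq {E : Finset (Window n)} (hE : E.Nonempty) {k : Fin N} {c : ℝ}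
    (hc : IsMeanCost E D κ M s k c) : meanCost E D κ M s k = c := by
  have h : ∃ c, IsMeanCost E D κ M s k c := ⟨c, hc⟩
  obtain ⟨x, hx⟩ := hE
  obtain ⟨ω, h1, h2⟩ := ((h.choose_spec x hx).and (hc x hx)).exists
  rw [meanCost, dif_pos h]
  exact tendsto_nhds_unique h1.2 h2.2

end MeanCost

/-! ### The window chain and its uniform Poisson bound -/

section WindowMatrix

variable {n N : ℕ} [NeZero N] (D : DefaultStrategy n) (κ : ℝ≥0)
  (s : Fin N → AttachmentMethod n)

open Classical in
/-- The transition matrix of the window on `E`. -/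
noncomputable def windowMatrix (E : Finset (Window n)) : Matrix E E ℝ :=
  fun x y => ∑ z, (recordLaw D κ s x.1 z).toReal * if z.next = y.1 then 1 else 0

variable {D s} {E : Finset (Window n)}

theorem windowMatrix_mulVec (hD : ClosedUnder E D.attach) (hs : ∀ i, ClosedUnder E (s i))
    (g : Window n → ℝ) (x : E) :
    (windowMatrix D κ s E).mulVec (fun y => g y.1) x = stepMean D κ s g x.1 := by
  classical
  simp only [Matrix.mulVec, dotProduct, windowMatrix, Finset.sum_mul]
  rw [Finset.sum_comm]
  refine Finset.sum_congr rfl fun z _ => ?_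
  by_cases hz : recordLaw D κ s x.1 z = 0
  · simp [hz]
  · have hmem := recordLaw_next_mem D κ s hD hs x.2 hz
    rw [Finset.sum_eq_single ⟨z.next, hmem⟩]
    · simp
    · intro y _ hy
      rw [if_neg fun h => hy (Subtype.ext h.symm)]
      simp
    · simp

theorem windowMatrix_rowSum (hD : ClosedUnder E D.attach) (hs : ∀ i, ClosedUnder E (s i)) (x : E) :
    ∑ y, windowMatrix D κ s E x y = 1 := by
  have := windowMatrix_mulVec κ hD hs (fun _ => 1) x
  simpa [Matrix.mulVec, dotProduct, stepMean, sum_toReal_pmf] using this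

theorem windowMatrix_nonneg (x y : E) : 0 ≤ windowMatrix D κ s E x y :=
  Finset.sum_nonneg fun z _ => mul_nonneg ENNReal.toReal_nonneg (by split_ifs <;> norm_num)

/-- The issuer `none` alone contributes the left-hand side. The factor is free of `N` and `s`, which
is the source of all uniformity. -/
theorem mul_transitionMatrix_le (x y : E) :
    ((κ / (κ + 1) : ℝ≥0) : ℝ) * transitionMatrix E D.attach x y ≤ windowMatrix D κ s E x y := by
  classical
  have h : windowMatrix D κ s E x y = ∑ o, (issuerWeight κ N o : ℝ) *
      ∑ p, (methodOf D s o x.1 p).toReal * if x.1.attach p = y.1 then 1 else 0 := by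
    rw [← sum_recordLaw_of_approved D κ s x.1 fun _ p => if x.1.attach p = y.1 then 1 else 0]
    refine Finset.sum_congr rfl fun z _ => ?_
    by_cases hz : recordLaw D κ s x.1 z = 0
    · simp [hz]
    · rw [Record.next, recordLaw_window D κ s hz]
  have hT : transitionMatrix E D.attach x y =
      ∑ p, (D.attach x.1 p).toReal * if x.1.attach p = y.1 then 1 else 0 := by
    rw [transitionMatrix, PMF.map_apply, tsum_fintype, ENNReal.toReal_sum]
    · refine Finset.sum_congr rfl fun p _ => ?_
      by_cases hp : x.1.attach p = y.1
      · simp [hp]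
      · simp [hp, Ne.symm hp]
    · intro p _
      split_ifs
      · exact PMF.apply_ne_top _ _
      · simp
  rw [h, hT]
  refine Finset.single_le_sum (f := fun o => (issuerWeight κ N o : ℝ) *
      ∑ p, (methodOf D s o x.1 p).toReal * if x.1.attach p = y.1 then 1 else 0)
    (fun o _ => mul_nonneg (NNReal.coe_nonneg _) (Finset.sum_nonneg fun p _ =>
      mul_nonneg ENNReal.toReal_nonneg (by split_ifs <;> norm_num))) (Finset.mem_univ none)

/-- The Poisson equation of the window chain has solutions, and the bound on them depends neither
on the number of selfish nodes nor on their strategies. -/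
theorem exists_bounded_poisson {n : ℕ} {D : DefaultStrategy n} {E : Finset (Window n)}
    (hD : AssumptionD E D) {κ : ℝ≥0} (hκ : 0 < κ) :
    ∃ K : ℝ, 0 ≤ K ∧ ∀ (N : ℕ) [NeZero N] (s : Fin N → AttachmentMethod n),
      (∀ i, ClosedUnder E (s i)) → ∀ (f : Window n → ℝ) (b : ℝ), (∀ x, |f x| ≤ b) →
      ∃ (c : ℝ) (g : Window n → ℝ), (∀ x ∈ E, f x - c = g x - stepMean D κ s g x) ∧
        ∀ x, |g x| ≤ K * (2 * b) := by
  classical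
  obtain ⟨⟨x₀, hx₀⟩, hcl, hirr, -⟩ := hD
  have : Nonempty E := ⟨⟨x₀, hx₀⟩⟩
  have ha : (0 : ℝ) < (κ / (κ + 1) : ℝ≥0) := by
    have : 0 < κ / (κ + 1) := by positivity
    exact_mod_cast this
  obtain ⟨K, hK0, hK⟩ := exists_oscillation_bound hirr ha
  refine ⟨K, hK0, fun N _ s hs f b hf => ?_⟩
  have hb : 0 ≤ b := (abs_nonneg _).trans (hf x₀)
  have hrow := windowMatrix_rowSum κ hcl hs
  obtain ⟨c, g, hg⟩ := exists_poisson hirr ha (mul_transitionMatrix_le κ) hrow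
    (fun x : E => f x.1)
  have hc : |c| ≤ b := abs_const_le_of_poisson (windowMatrix_nonneg κ) hrow hg fun x => hf x.1
  -- The constant `2 * b` bounds `|f - c|`, since `|c| ≤ b`.
  have hosc : ∀ x y, g x - g y ≤ K * (2 * b) :=
    hK _ (mul_transitionMatrix_le κ) hrow g (2 * b) fun x => by
      rw [← hg x]
      refine (abs_sub _ _).trans ?_
      linarith [hf x.1]
  -- Normalising at `x₀` turns the oscillation bound into a sup bound. The value `0` off `E` keeps
  -- it valid for all windows and is harmless, because the chain does not leave `E`.
  let g' : Window n → ℝ := fun x => if hx : x ∈ E then g ⟨x, hx⟩ - g ⟨x₀, hx₀⟩ else 0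
  have hg' : ∀ x : E, g' x.1 = g x - g ⟨x₀, hx₀⟩ := fun x => dif_pos x.2
  refine ⟨c, g', fun x hx => ?_, fun x => ?_⟩
  · have hmul : (windowMatrix D κ s E).mulVec (fun y => g' y.1) ⟨x, hx⟩ =
        (windowMatrix D κ s E).mulVec g ⟨x, hx⟩ - g ⟨x₀, hx₀⟩ := by
      simp only [Matrix.mulVec, dotProduct, hg', mul_sub, Finset.sum_sub_distrib]
      rw [← Finset.sum_mul, hrow, one_mul]
    rw [← windowMatrix_mulVec κ hcl hs g' ⟨x, hx⟩, hmul, hg' ⟨x, hx⟩]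
    linarith [hg ⟨x, hx⟩]
  · by_cases hx : x ∈ E
    · rw [hg' ⟨x, hx⟩]
      exact abs_le.mpr ⟨by linarith [hosc ⟨x₀, hx₀⟩ ⟨x, hx⟩], hosc _ _⟩
    · simp only [g', dif_neg hx, abs_zero]
      positivity

end WindowMatrix

/-! ### The effect of one node changing its strategy -/

section Perturbation

variable {n N : ℕ} [NeZero N] (D : DefaultStrategy n) (κ : ℝ≥0) (M : ℕ)
  (s : Fin N → AttachmentMethod n) (k : Fin N) (S' : AttachmentMethod n)

/-- Only the summand of issuer `k` changes; it is the weight of `k` times a difference of two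
averages bounded by `b`. -/
theorem abs_sum_recordLaw_update_sub_le (x : Window n) {φ : Record n N → ℝ} {b : ℝ}
    (hφ : ∀ z, |φ z| ≤ b) :
    |∑ z, (recordLaw D κ (Function.update s k S') x z).toReal * φ z -
      ∑ z, (recordLaw D κ s x z).toReal * φ z| ≤ 2 * issuerWeight κ N (some k) * b := by
  rw [sum_recordLaw, sum_recordLaw, ← Finset.sum_sub_distrib, Finset.sum_eq_single (some k)]
  · rw [← mul_sub, abs_mul, abs_of_nonneg (NNReal.coe_nonneg _), mul_comm 2, mul_assoc]
    refine mul_le_mul_of_nonneg_left ?_ (NNReal.coe_nonneg _)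
    rw [two_mul]
    exact (abs_sub _ _).trans (add_le_add
      (abs_sum_pmf_mul_le _ fun p => abs_sum_pmf_mul_le _ fun e => hφ _)
      (abs_sum_pmf_mul_le _ fun p => abs_sum_pmf_mul_le _ fun e => hφ _))
  · intro o _ ho
    have : methodOf D (Function.update s k S') o = methodOf D s o := by
      cases o with
      | none => rfl
      | some i => exact Function.update_of_ne (fun h => ho (congrArg some h)) _ _
    rw [this, sub_self]
  · simp

/-- If a single selfish node changes its strategy, the law of the first `T` records changes
little. -/
theorem abs_integral_update_sub_le (T : ℕ) {b : ℝ} :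
    ∀ (y : Window n) (F : (ℕ → Record n N) → ℝ), DependsOn F (Set.Iio T) → (∀ ω, |F ω| ≤ b) →
      |∫ ω, F ω ∂(tangleLaw D κ (Function.update s k S') y) - ∫ ω, F ω ∂(tangleLaw D κ s y)| ≤
        T * (2 * issuerWeight κ N (some k) * b) := by
  induction T with
  | zero =>
    intro y F hF hb
    obtain ⟨ω₀⟩ : Nonempty (ℕ → Record n N) :=
      nonempty_of_isProbabilityMeasure (tangleLaw D κ s y)
    have : ∀ ω, F ω = F ω₀ := fun ω => hF fun i hi => absurd hi (by simp)
    simp_rw [this]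
    simp
  | succ T ih =>
    intro y F hF hb
    have hFm := measurable_of_dependsOn_Iio hF
    rw [integral_tangleLaw D κ _ y hFm hb, integral_tangleLaw D κ _ y hFm hb]
    set s' := Function.update s k S' with hs'
    set I' : Record n N → ℝ := fun z => ∫ ω, F (consSeq z ω) ∂(tangleLaw D κ s' z.next) with hI'
    set I : Record n N → ℝ := fun z => ∫ ω, F (consSeq z ω) ∂(tangleLaw D κ s z.next) with hI
    have hIb : ∀ z, |I' z| ≤ b := fun z => by
      refine (norm_integral_le_of_norm_le_const (μ := tangleLaw D κ s' z.next)
        (ae_of_all _ fun ω => (Real.norm_eq_abs _).le.trans (hb (consSeq z ω)))).trans ?_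
      simp
    -- First the law of the initial record is exchanged, then that of the continuation, which is
    -- left to the induction.
    have hsplit : ∑ z, (recordLaw D κ s' y z).toReal * I' z -
        ∑ z, (recordLaw D κ s y z).toReal * I z =
        (∑ z, (recordLaw D κ s' y z).toReal * I' z - ∑ z, (recordLaw D κ s y z).toReal * I' z) +
          ∑ z, (recordLaw D κ s y z).toReal * (I' z - I z) := by
      simp_rw [mul_sub, Finset.sum_sub_distrib]
      ring
    rw [hsplit]
    have h1 := abs_sum_recordLaw_update_sub_le D κ s k S' y hIb
    have h2 := abs_sum_pmf_mul_le (recordLaw D κ s y) fun z =>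
      ih z.next (fun ω => F (consSeq z ω)) (dependsOn_comp_consSeq hF z) fun ω => hb _
    refine (abs_add_le _ _).trans ((add_le_add h1 h2).trans (le_of_eq ?_))
    push_cast
    ring

theorem abs_expectedCost_update_sub_le (S : AttachmentMethod n) (x : Window n) :
    |expectedCost D κ M (Function.update s k S') S x - expectedCost D κ M s S x| ≤
      M * (2 * issuerWeight κ N (some k) * M) := by
  rw [expectedCost, expectedCost, ← Finset.sum_sub_distrib]
  simp_rw [← mul_sub]
  exact abs_sum_pmf_mul_le _ fun p =>
    abs_integral_update_sub_le D κ s k S' M _ _ (dependsOn_missed M) (abs_missed_le M)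

end Perturbation

/-! ### Copying another node's strategy -/

section Nash

variable {n : ℕ} {D : DefaultStrategy n} {E : Finset (Window n)} {κ : ℝ≥0}

theorem closedUnder_of_mem_mixedStrategies {A : Set (AttachmentMethod n)}
    (hA : ∀ J ∈ A, ClosedUnder E J) {S : AttachmentMethod n} (hS : S ∈ mixedStrategies A) :
    ClosedUnder E S := by
  obtain ⟨Ξ, hΞ⟩ := hS
  intro x hx p hp
  rw [hΞ x, PMF.mem_support_bind_iff] at hp
  obtain ⟨β, -, hβ⟩ := hp
  exact hA β.1 β.2 x hx p hβ

theorem isMeanCost_meanCost (hD : AssumptionD E D) (hκ : 0 < κ) (M : ℕ) {N : ℕ} [NeZero N]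
    {s : Fin N → AttachmentMethod n} (hs : ∀ i, ClosedUnder E (s i)) (k : Fin N) :
    IsMeanCost E D κ M s k (meanCost E D κ M s k) := by
  obtain ⟨K, -, hK⟩ := exists_bounded_poisson hD hκ
  obtain ⟨c, g, hg, -⟩ := hK N s hs _ M (abs_expectedCost_le D κ M s (s k))
  have h := isMeanCost_of_poisson D κ M s hD.2.1 hs k hg
  rwa [meanCost_eq D κ M s hD.1 h]

/-- When there are many selfish nodes, a node that copies the strategy of another one gets
nearly the cost that the other one had before. -/
theorem exists_abs_meanCost_update_sub_le (hD : AssumptionD E D) (hκ : 0 < κ) {M : ℕ}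
    (hM : 0 < M) :
    ∃ K : ℝ, ∀ (N : ℕ) [NeZero N] (s : Fin N → AttachmentMethod n),
      (∀ i, ClosedUnder E (s i)) → ∀ k j,
      |meanCost E D κ M (Function.update s k (s j)) k - meanCost E D κ M s j| ≤
        issuerWeight κ N (some k) * K := by
  obtain ⟨K, -, hK⟩ := exists_bounded_poisson hD hκ
  refine ⟨2 * (M + 2 * K), fun N _ s hs k j => ?_⟩
  set s' := Function.update s k (s j) with hs'
  have hs'c : ∀ i, ClosedUnder E (s' i) := fun i => by
    rw [hs', Function.update_apply]
    split_ifs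
    · exact hs j
    · exact hs i
  -- Both Poisson equations now have the expected cost of the same method `s j` on the left; only
  -- the environment differs.
  have hk : s' k = s j := Function.update_self ..
  obtain ⟨c, g, hg, hgb⟩ := hK N s hs _ M (abs_expectedCost_le D κ M s (s j))
  obtain ⟨c', g', hg', -⟩ := hK N s' hs'c _ M (abs_expectedCost_le D κ M s' (s' k))
  rw [meanCost_eq D κ M s hD.1 (isMeanCost_of_poisson D κ M s hD.2.1 hs j hg),
    meanCost_eq D κ M s' hD.1 (isMeanCost_of_poisson D κ M s' hD.2.1 hs'c k hg'), ← mul_sub]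
  set w : ℝ := (issuerWeight κ N (some k) : ℝ) with hw
  have hM' : (0 : ℝ) < M := Nat.cast_pos.mpr hM
  have : Nonempty E := hD.1.to_subtype
  -- Subtracting the equations and writing `P' g' - P g = P' (g' - g) + (P' - P) g` gives a Poisson
  -- equation for `P'` with unknown `g' - g` and constant `c' - c`. Its source `f` involves only the
  -- old `g`, so no bound on `g'` is needed.
  let f : E → ℝ := fun x => (expectedCost D κ M s' (s j) x.1 - expectedCost D κ M s (s j) x.1) +
    (stepMean D κ s' g x.1 - stepMean D κ s g x.1)
  have hf : ∀ x, |f x| ≤ M * (2 * w * M) + 2 * w * (K * (2 * M)) := fun x =>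
    (abs_add_le _ _).trans (add_le_add (abs_expectedCost_update_sub_le D κ M s k (s j) (s j) x.1)
      (abs_sum_recordLaw_update_sub_le D κ s k (s j) x.1 fun z => hgb z.next))
  have hpois : ∀ x : E, f x - (c' - c) =
      (g' x.1 - g x.1) - (windowMatrix D κ s' E).mulVec (fun y => g' y.1 - g y.1) x := fun x => by
    rw [windowMatrix_mulVec κ hD.2.1 hs'c (fun y => g' y - g y)]
    have h1 := hg x.1 x.2
    have h2 := hg' x.1 x.2
    rw [hk] at h2
    have h3 : stepMean D κ s' (fun y => g' y - g y) x.1 =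
        stepMean D κ s' g' x.1 - stepMean D κ s' g x.1 := by
      simp only [stepMean, mul_sub, Finset.sum_sub_distrib]
    rw [h3]
    simp only [f]
    linarith
  have hcc : |c' - c| ≤ M * (2 * w * M) + 2 * w * (K * (2 * M)) :=
    abs_const_le_of_poisson (windowMatrix_nonneg κ) (windowMatrix_rowSum κ hD.2.1 hs'c) hpois hf
  rw [abs_mul, abs_of_nonneg (by positivity : (0 : ℝ) ≤ (M : ℝ)⁻¹), inv_mul_le_iff₀ hM']
  refine hcc.trans (le_of_eq ?_)
  ring

theorem issuerWeight_some_le (N : ℕ) [NeZero N] (k : Fin N) :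
    (issuerWeight κ N (some k) : ℝ) ≤ 1 / N := by
  have hN : (0 : ℝ) < N := Nat.cast_pos.mpr (NeZero.pos N)
  simp only [issuerWeight, NNReal.coe_div, NNReal.coe_one, NNReal.coe_mul, NNReal.coe_add,
    NNReal.coe_natCast]
  refine one_div_le_one_div_of_le hN ?_
  nlinarith [κ.coe_nonneg]

end Nash

end Tangle

theorem theorem2 (n : ℕ) (E : Finset (Tangle.Window n)) (D : Tangle.DefaultStrategy n)
    (hD : Tangle.AssumptionD E D) (κ : ℝ≥0) (hκ : 0 < κ) (M : ℕ) (hM : 0 < M)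
    (ε : ℝ) (hε : 0 < ε) :
    ∃ N₀ : ℕ, ∀ (N : ℕ) [NeZero N], N₀ ≤ N →
      ∀ A : Set (Tangle.AttachmentMethod n), (∀ J ∈ A, Tangle.ClosedUnder E J) →
        (∀ s : Fin N → Tangle.AttachmentMethod n, (∀ i, s i ∈ Tangle.mixedStrategies A) →
          ∀ k, Tangle.IsMeanCost E D κ M s k (Tangle.meanCost E D κ M s k)) ∧
        ∀ s : Fin N → Tangle.AttachmentMethod n,
          Tangle.IsNashEquilibrium E D κ M (Tangle.mixedStrategies A) s →
          ∀ k j, |Tangle.meanCost E D κ M s k - Tangle.meanCost E D κ M s j| < ε := by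
  obtain ⟨K, hK⟩ := Tangle.exists_abs_meanCost_update_sub_le hD hκ hM
  -- `K` was obtained before `N`, the simple strategies and the strategy vector were introduced, so
  -- `N₀` does not depend on them.
  obtain ⟨N₀, hN₀⟩ := exists_nat_gt (|K| / ε)
  refine ⟨N₀, fun N _ hN A hA => ⟨fun s hs k => Tangle.isMeanCost_meanCost hD hκ M
    (fun i => Tangle.closedUnder_of_mem_mixedStrategies hA (hs i)) k, fun s hs => ?_⟩⟩
  have hNpos : (0 : ℝ) < N := Nat.cast_pos.mpr (NeZero.pos N)
  have hcl := fun i => Tangle.closedUnder_of_mem_mixedStrategies hA (hs.1 i)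
  have hlt : ∀ k j, Tangle.meanCost E D κ M s k - Tangle.meanCost E D κ M s j < ε := by
    intro k j
    -- Copying `j` is an admissible deviation, because `s j` is itself a component of the
    -- equilibrium.
    have h1 := hs.2 k (s j) (hs.1 j)
    have h2 := (le_abs_self _).trans (hK N s hcl k j)
    have h3 : (Tangle.issuerWeight κ N (some k) : ℝ) * K < ε := by
      calc (Tangle.issuerWeight κ N (some k) : ℝ) * K
          ≤ Tangle.issuerWeight κ N (some k) * |K| :=
            mul_le_mul_of_nonneg_left (le_abs_self K) (NNReal.coe_nonneg _)
        _ ≤ 1 / N * |K| :=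
            mul_le_mul_of_nonneg_right (Tangle.issuerWeight_some_le N k) (abs_nonneg K)
        _ < ε := by
            rw [one_div_mul_eq_div, div_lt_iff₀ hNpos]
            have h4 : |K| / ε < N := hN₀.trans_le (Nat.cast_le.mpr hN)
            rw [div_lt_iff₀ hε] at h4
            linarith
    linarith
  intro k j
  exact abs_lt.mpr ⟨by linarith [hlt j k], hlt k j⟩
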